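/- Let $\mathbb T=\mathbb R/\mathbb Z$, let $\|x\|_{\mathbb R/\mathbb Z}$ be the distance of $x$ to the nearest integer, and let $0<\tau_0\le 1$. Let $f,g:\mathbb T\to\mathbb R$ be $\tau_0$-Hölder continuous. Suppose that there are $m\ge 1$, points $\theta_1,\dots,\theta_m\in\mathbb T$ and exponents $\tau_1,\dots,\tau_m\in(0,1]$ such that $$f(\theta)=\widetilde f(\theta)\prod_{\ell=1}^m|\sin\pi(\theta-\theta_\ell)|^{\tau_\ell}\qquad(\theta\in\mathbb T),$$ where $\widetilde f:\mathbb T\to\mathbb R$ is continuous and $\inf_{\mathbb T}|\widetilde f|>0$. Let $\alpha\in\mathbb R\setminus\mathbb Q$, with continued fraction convergents $p_n/q_n$. For $E\in\mathbb R$ put $$A(x)=\begin{pmatrix}E-\frac{g(x)}{f(x)}&-1\\1&0\end{pmatrix},\qquad A_n(x)=A(x+(n-1)\alpha)\cdots A(x+\alpha)A(x).$$ Then for every $E\in\mathbb R$ the functions $\ln\|A_n(\cdot)\|$ are integrable on $\mathbb T$, and the Lyapunov exponent $$L(E)=\lim_{n\to\infty}\frac1n\int_{\mathbb T}\ln\|A_n(x)\|\,dx$$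 exists as a finite limit. Let $\theta\in\mathbb T$ be such that $f(\theta+n\alpha)\ne0$ for all $n\in\mathbb Z$, and let $$\delta(\alpha,\theta)=\limsup_{n\to\infty}\frac{\sum_{\ell=1}^m\tau_\ell\ln\|q_n(\theta-\theta_\ell)\|_{\mathbb R/\mathbb Z}+\tau_{\min}\ln q_{n+1}}{q_n}\in[-\infty,\infty],\qquad \tau_{\min}=\min_{0\le\ell\le m}\tau_\ell,$$ with $\ln 0=-\infty$. Then the Schrödinger operator on $\ell^2(\mathbb Z)$ $$(H_{\alpha,\theta}u)_n=u_{n+1}+u_{n-1}+\frac{g(\theta+n\alpha)}{f(\theta+n\alpha)}\,u_n,$$ with its maximal domain $\{u\in\ell^2(\mathbb Z): H_{\alpha,\theta}u\in\ell^2(\mathbb Z)\}$, has no eigenvalues in the set $\{E\in\mathbb R: L(E)<\delta(\alpha,\theta)\}$. -/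

import Mathlib

open Filter Topology MeasureTheory
open scoped NNReal ENNReal Matrix.Norms.L2Operator

noncomputable section

namespace UnboundedQP

/-- `f` is `τ`-Hölder continuous on the circle `ℝ/ℤ` (with respect to the distance of `ℝ/ℤ`).
The circle is compact, so the supremum of `|f|` is then automatically finite. -/
def IsHolder (τ : ℝ≥0) (f : UnitAddCircle → ℝ) : Prop :=
  ∃ C : ℝ≥0, HolderWith C τ f

theorem absSinPi_periodic :
    Function.Periodic (fun x : ℝ => |Real.sin (Real.pi * x)|) 1 := by
  intro x
  simp [mul_add, Real.sin_add]

/-- The function `|sin π x|` on the circle `ℝ/ℤ`. -/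
def absSinPi : UnitAddCircle → ℝ := absSinPi_periodic.lift

/-- `f` belongs to the class `𝓕`, with the given base points `z ℓ` and exponents `τ ℓ`
(`ℓ = 1, …, m`, `m ≥ 1`): `f` is the product of `∏ |sin π (x - z ℓ)| ^ τ ℓ` and of a continuous
function `F` with `inf |F| > 0`. -/
structure ClassF (f : UnitAddCircle → ℝ) {m : ℕ} (z : Fin m → UnitAddCircle)
    (τ : Fin m → ℝ) : Prop where
  one_le : 1 ≤ m
  exponent_pos : ∀ l, 0 < τ l
  exponent_le_one : ∀ l, τ l ≤ 1
  factor : ∃ F : UnitAddCircle → ℝ, Continuous F ∧ (∃ c : ℝ, 0 < c ∧ ∀ x, c ≤ |F x|) ∧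
    ∀ x, f x = F x * ∏ l, absSinPi (x - z l) ^ τ l

/-- The `n`-th point `θ + n α` of the orbit of `θ` on the circle. -/
def orbit (α : ℝ) (θ : UnitAddCircle) (n : ℤ) : UnitAddCircle :=
  θ + n • (α : UnitAddCircle)

/-- The potential `n ↦ g(θ + n α) / f(θ + n α)`. -/
def potential (f g : UnitAddCircle → ℝ) (α : ℝ) (θ : UnitAddCircle) (n : ℤ) : ℝ :=
  g (orbit α θ n) / f (orbit α θ n)

/-- The Hilbert space `ℓ²(ℤ)`. -/
abbrev EllTwo : Type := lp (fun _ : ℤ => ℂ) 2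

/-- The discrete Schrödinger expression `u_{n+1} + u_{n-1} + V_n u_n` on all sequences. -/
def schrodingerExpr (V : ℤ → ℝ) (u : ℤ → ℂ) (n : ℤ) : ℂ :=
  u (n + 1) + u (n - 1) + (V n : ℂ) * u n

theorem schrodingerExpr_add (V : ℤ → ℝ) (u v : ℤ → ℂ) :
    schrodingerExpr V (u + v) = schrodingerExpr V u + schrodingerExpr V v := by
  funext n
  simp only [schrodingerExpr, Pi.add_apply]
  ring

theorem schrodingerExpr_smul (V : ℤ → ℝ) (c : ℂ) (u : ℤ → ℂ) :
    schrodingerExpr V (c • u) = c • schrodingerExpr V u := by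
  funext n
  simp only [schrodingerExpr, Pi.smul_apply, smul_eq_mul]
  ring

/-- The (in general unbounded) Schrödinger operator with potential `V` on `ℓ²(ℤ)`, on its maximal
domain `{u ∈ ℓ²(ℤ) : u_{n+1} + u_{n-1} + V_n u_n ∈ ℓ²(ℤ)}`. -/
def schrodinger (V : ℤ → ℝ) : EllTwo →ₗ.[ℂ] EllTwo where
  domain :=
    { carrier := {u | Memℓp (schrodingerExpr V (u : ℤ → ℂ)) 2}
      zero_mem' := by
        have h : schrodingerExpr V ((0 : EllTwo) : ℤ → ℂ) = 0 := by
          funext n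
          simp [schrodingerExpr]
        show Memℓp (schrodingerExpr V ((0 : EllTwo) : ℤ → ℂ)) 2
        rw [h]
        exact zero_memℓp
      add_mem' := by
        intro u v hu hv
        show Memℓp (schrodingerExpr V ((u + v : EllTwo) : ℤ → ℂ)) 2
        rw [lp.coeFn_add, schrodingerExpr_add]
        exact Memℓp.add hu hv
      smul_mem' := by
        intro c u hu
        show Memℓp (schrodingerExpr V ((c • u : EllTwo) : ℤ → ℂ)) 2
        rw [lp.coeFn_smul, schrodingerExpr_smul]
        exact Memℓp.const_smul hu c }
  toFun :=
    { toFun := fun u => ⟨schrodingerExpr V ((u : EllTwo) : ℤ → ℂ), u.2⟩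
      map_add' := by
        intro u v
        apply Subtype.ext
        exact schrodingerExpr_add V _ _
      map_smul' := by
        intro c u
        apply Subtype.ext
        exact schrodingerExpr_smul V c _ }

/-- `z` is an eigenvalue of the partially defined operator `T`. -/
def IsEigenvalue (T : EllTwo →ₗ.[ℂ] EllTwo) (z : ℂ) : Prop :=
  ∃ u : T.domain, u ≠ 0 ∧ T u = z • (u : EllTwo)

/-- The transfer matrix `A(x)` at energy `E`. It is only meaningful off the zeros of `f`,
which form a finite set. -/
def transfer (f g : UnitAddCircle → ℝ) (E : ℝ) (x : UnitAddCircle) : Matrix (Fin 2) (Fin 2) ℝ :=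
  !![E - g x / f x, -1; 1, 0]

/-- The iterates `A_n(x) = A(x + (n-1) α) ⋯ A(x + α) A(x)` of the cocycle `(α, A)`. -/
def transferIter (f g : UnitAddCircle → ℝ) (α E : ℝ) :
    ℕ → UnitAddCircle → Matrix (Fin 2) (Fin 2) ℝ
  | 0, _ => 1
  | n + 1, x => transfer f g E (orbit α x n) * transferIter f g α E n x

/-- The averages `(1/n) ∫ log ‖A_n(x)‖ dx`, with the operator norm on the matrices and the
Haar probability measure on the circle. -/
def lyapunovAverage (f g : UnitAddCircle → ℝ) (α E : ℝ) (n : ℕ) : ℝ :=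
  (1 / (n : ℝ)) * ∫ x : UnitAddCircle, Real.log ‖transferIter f g α E n x‖

/-- The Lyapunov exponent `L(E) = lim (1/n) ∫ log ‖A_n(x)‖ dx`. -/
def lyapunov (f g : UnitAddCircle → ℝ) (α E : ℝ) : ℝ :=
  limUnder atTop (lyapunovAverage f g α E)

/-- The denominator `q_n` of the `n`-th continued fraction convergent `p_n / q_n` of `α`. -/
def cfDen (α : ℝ) (n : ℕ) : ℕ := (α.convergent n).den

/-- The smallest of the numbers `τ₀, τ 1, …, τ m`. -/
def tauMin (τ₀ : ℝ≥0) {m : ℕ} (τ : Fin m → ℝ) : ℝ :=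
  Finset.univ.fold min (τ₀ : ℝ) τ

/-- The index
`δ = limsup (∑ τ ℓ * log ‖q_n (θ - z ℓ)‖ + τ_min * log q_{n+1}) / q_n`
as an extended real number. The norm of the circle is the distance to the nearest integer, and the
logarithm of the distance is `-∞` where the distance is `0`. -/
def deltaIndex (τ₀ : ℝ≥0) {m : ℕ} (z : Fin m → UnitAddCircle) (τ : Fin m → ℝ)
    (α : ℝ) (θ : UnitAddCircle) : EReal :=
  limsup (fun n : ℕ =>
    ((∑ l, (τ l : EReal) * ENNReal.log ‖cfDen α n • (θ - z l)‖ₑ)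
      + ((tauMin τ₀ τ * Real.log (cfDen α (n + 1)) : ℝ) : EReal))
        / ((cfDen α n : ℝ) : EReal)) atTop

end UnboundedQP

end

/-! This is Gordon's argument adapted to an unbounded potential. An eigenfunction yields a real
solution w tending to zero in both directions. Write W(k) for the column (w k, w (k-1)), q for q_n
and M for A_q(θ), which has determinant one. If A were q-periodic along the orbit, then M W(0), M⁻¹
W(0) and M² W(0) would be W(q), W(-q) and W(2q), all small for large q. By Cayley–Hamilton, M + M⁻¹
= tr M; hence tr M would be small, M² W(0) would be close to -W(0), and W(0) would vanish
(`eq_zero_of_tendsto_mul`).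

In truth A_q(θ ± qα) differs from M, and A has poles. The comparison is made for the continuous
cocycle D = f A, divided by the product P_q(θ) of f along the orbit. Since ‖qα‖ ≤ 1/q_{n+1},
telescoping and Hölder continuity bound D_q(θ ± qα) - D_q(θ) by about exp(q (L + ∫ log |f|))
q_{n+1}^(-τ₀). The identity ∏ 2|sin π(x + jp/q)| = 2|sin πqx| shows that |P_q(θ)| is at least about
exp(q ∫ log |f|) ∏ ‖q(θ - θ_ℓ)‖^τ_ℓ. For L < c < δ there are infinitely many n along which the
quotient is at most about exp(q (L - c)), so it tends to zero
(`tendsto_norm_cocycle_shift_sub_div`). The ratio P_q(θ ± qα) / P_q(θ) multiplies a column that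
tends to zero, so an upper bound for it is enough (`eventually_abs_orbitProd_le`).

The growth rate of D holds uniformly in x: norms of D_N truncated away from zero have continuous
logarithms, to which Weyl equidistribution applies (`exists_continuous_rate`). The limit L itself
comes from Fekete's lemma, the averages being nonnegative because the determinant is one. -/

namespace UnboundedQP

/-! ### The function |sin πx| on the circle -/

section Sine

theorem absSinPi_coe (r : ℝ) : absSinPi (r : UnitAddCircle) = |Real.sin (Real.pi * r)| := rfl

/-- The chord formula turns estimates for the sine into the triangle inequality in ℂ and products of
sines into products over roots of unity. -/
theorem absSinPi_eq_norm_toCircle_sub_one (x : UnitAddCircle) :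
    absSinPi x = ‖(AddCircle.toCircle x : ℂ) - 1‖ / 2 := by
  induction x using QuotientAddGroup.induction_on with
  | H r =>
    rw [absSinPi_coe, AddCircle.toCircle_apply_mk, Circle.coe_exp, mul_comm _ Complex.I,
      Complex.norm_exp_I_mul_ofReal_sub_one, norm_mul]
    simp only [Real.norm_eq_abs]
    rw [show 2 * Real.pi / 1 * r / 2 = Real.pi * r by ring]
    norm_num

theorem exists_coe_eq_abs_eq_norm (x : UnitAddCircle) :
    ∃ r : ℝ, (r : UnitAddCircle) = x ∧ |r| = ‖x‖ ∧ |r| ≤ 1 / 2 := by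
  induction x using QuotientAddGroup.induction_on with
  | H r =>
    change ∃ s : ℝ, (s : UnitAddCircle) = (r : UnitAddCircle) ∧ |s| = ‖(r : UnitAddCircle)‖ ∧ _
    refine ⟨r - round r, ?_, UnitAddCircle.norm_eq.symm, abs_sub_round r⟩
    rw [AddCircle.coe_sub, sub_eq_self]
    exact_mod_cast (AddCircle.coe_eq_zero_iff (1 : ℝ)).2 ⟨round r, by simp⟩

theorem two_mul_norm_le_absSinPi (x : UnitAddCircle) : 2 * ‖x‖ ≤ absSinPi x := by
  obtain ⟨r, rfl, hr, hr2⟩ := exists_coe_eq_abs_eq_norm x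
  rw [absSinPi_coe, ← hr]
  have hpi := Real.pi_pos
  have h := Real.mul_abs_le_abs_sin (x := Real.pi * r) (by
    rw [abs_mul, abs_of_pos hpi]; nlinarith)
  rw [abs_mul, abs_of_pos hpi] at h
  calc 2 * |r| = 2 / Real.pi * (Real.pi * |r|) := by field_simp
    _ ≤ _ := h

theorem absSinPi_le_pi_mul_norm (x : UnitAddCircle) : absSinPi x ≤ Real.pi * ‖x‖ := by
  obtain ⟨r, rfl, hr, -⟩ := exists_coe_eq_abs_eq_norm x
  rw [absSinPi_coe, ← hr, ← abs_of_pos Real.pi_pos, ← abs_mul, abs_of_pos Real.pi_pos]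
  exact Real.abs_sin_le_abs

theorem absSinPi_nonneg (x : UnitAddCircle) : 0 ≤ absSinPi x := by
  rw [absSinPi_eq_norm_toCircle_sub_one]; positivity

theorem absSinPi_eq_zero_iff {x : UnitAddCircle} : absSinPi x = 0 ↔ x = 0 := by
  constructor
  · intro h
    have := two_mul_norm_le_absSinPi x
    exact norm_le_zero_iff.1 (by linarith)
  · rintro rfl
    exact le_antisymm (by simpa using absSinPi_le_pi_mul_norm 0) (absSinPi_nonneg 0)

theorem absSinPi_sub_le (x y : UnitAddCircle) : absSinPi x - absSinPi y ≤ Real.pi * ‖x - y‖ := by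
  refine le_trans ?_ (absSinPi_le_pi_mul_norm (x - y))
  simp only [absSinPi_eq_norm_toCircle_sub_one]
  have h1 : ‖(AddCircle.toCircle (x - y) : ℂ) - 1‖
      = ‖(AddCircle.toCircle x : ℂ) - AddCircle.toCircle y‖ := by
    have h2 : (AddCircle.toCircle x : ℂ)
        = AddCircle.toCircle (x - y) * AddCircle.toCircle y := by
      rw [← Circle.coe_mul, ← AddCircle.toCircle_add, sub_add_cancel]
    rw [h2, ← sub_one_mul, norm_mul, Circle.norm_coe, mul_one]
  have h3 : ‖(AddCircle.toCircle x : ℂ) - 1‖ ≤ ‖(AddCircle.toCircle x : ℂ) - AddCircle.toCircle y‖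
      + ‖(AddCircle.toCircle y : ℂ) - 1‖ := norm_sub_le_norm_sub_add_norm_sub _ _ _
  rw [h1]
  linarith

theorem continuous_absSinPi : Continuous absSinPi := by
  rw [show absSinPi = fun x => ‖(AddCircle.toCircle x : ℂ) - 1‖ / 2 from
    funext absSinPi_eq_norm_toCircle_sub_one]
  have := AddCircle.continuous_toCircle (T := 1)
  fun_prop

/-- Evaluate X^q - w^q = ∏ (X - ζ^j w) at X = 1, with ζ = e(p/q) a primitive q-th root of unity and
w = e(x), and take norms. -/
theorem prod_two_mul_absSinPi {p : ℤ} {q : ℕ} (hq : 0 < q) (hpq : IsCoprime p (q : ℤ))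
    (x : UnitAddCircle) :
    ∏ j ∈ Finset.range q, 2 * absSinPi (x + j • ((p / q : ℝ) : UnitAddCircle))
      = 2 * absSinPi (q • x) := by
  have hζ := Complex.isPrimitiveRoot_exp_of_isCoprime p q hq.ne' hpq
  have hζ' : (AddCircle.toCircle ((p / q : ℝ) : UnitAddCircle) : ℂ)
      = Complex.exp (2 * Real.pi * Complex.I * (p / q)) := by
    rw [AddCircle.toCircle_apply_mk, Circle.coe_exp]
    push_cast
    ring_nf
  rw [← hζ'] at hζ
  have h := congrArg (Polynomial.eval 1) (X_pow_sub_C_eq_prod hζ hq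
    (α := (AddCircle.toCircle x : ℂ)) rfl)
  rw [Polynomial.eval_prod] at h
  simp only [Polynomial.eval_sub, Polynomial.eval_pow, Polynomial.eval_X, one_pow,
    Polynomial.eval_C] at h
  have h2 := congrArg norm h
  rw [norm_prod] at h2
  simp only [absSinPi_eq_norm_toCircle_sub_one, mul_div_cancel₀ _ (two_ne_zero' ℝ),
    AddCircle.toCircle_nsmul, AddCircle.toCircle_add, Circle.coe_mul, Circle.coe_pow]
  rw [norm_sub_rev, h2]
  refine Finset.prod_congr rfl fun j _ => ?_
  rw [norm_sub_rev, mul_comm]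

theorem integrable_log_absSinPi : Integrable (fun x => Real.log (absSinPi x)) volume ∧
    ∫ x, Real.log (absSinPi x) = -Real.log 2 := by
  have hpi := Real.pi_pos
  have key : (fun r : ℝ => Real.log (absSinPi (r : UnitAddCircle)))
      = fun r : ℝ => (Real.log ∘ Real.sin) (Real.pi * r) := by
    funext r
    simp [absSinPi_coe]
  have hI : IntervalIntegrable (fun r : ℝ => (Real.log ∘ Real.sin) (Real.pi * r)) volume 0 1 := by
    have := (intervalIntegrable_log_sin (a := 0) (b := Real.pi)).comp_mul_left (c := Real.pi)
    simpa [hpi.ne'] using this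
  constructor
  · have hmp := UnitAddCircle.measurePreserving_mk 0
    have hm : AEStronglyMeasurable (fun x => Real.log (absSinPi x))
        (volume : Measure UnitAddCircle) :=
      (Real.measurable_log.comp continuous_absSinPi.measurable).aestronglyMeasurable
    rw [← hmp.integrable_comp hm]
    change Integrable (fun r : ℝ => Real.log (absSinPi (r : UnitAddCircle))) _
    rw [key]
    rw [zero_add]
    exact (intervalIntegrable_iff_integrableOn_Ioc_of_le zero_le_one).1 hI
  · rw [← UnitAddCircle.intervalIntegral_preimage 0, key, zero_add,
      intervalIntegral.integral_comp_mul_left _ hpi.ne']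
    simp only [mul_zero, mul_one, Function.comp_apply, integral_log_sin_zero_pi, smul_eq_mul]
    field_simp

end Sine

/-! ### Sine products along an irrational orbit -/

section Approximation

theorem norm_coe_le_abs (r : ℝ) : ‖(r : UnitAddCircle)‖ ≤ |r| := by
  rw [UnitAddCircle.norm_eq]
  simpa using round_le r 0

theorem norm_nsmul_coe_le {α : ℝ} {p : ℤ} {q : ℕ} {Q : ℝ} (hq : 0 < q)
    (hα : |α - p / q| ≤ 1 / (q * Q)) : ‖q • (α : UnitAddCircle)‖ ≤ 1 / Q := by
  have hq' : (0 : ℝ) < q := by exact_mod_cast hq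
  have h : q • (α : UnitAddCircle) = ((q * (α - p / q) : ℝ) : UnitAddCircle) := by
    rw [mul_sub, mul_div_cancel₀ _ hq'.ne', AddCircle.coe_sub,
      (AddCircle.coe_eq_zero_iff (1 : ℝ) (x := (p : ℝ))).2 ⟨p, by simp⟩, sub_zero,
      ← nsmul_eq_mul, AddCircle.coe_nsmul]
  rw [h]
  refine (norm_coe_le_abs _).trans ?_
  rw [abs_mul, abs_of_pos hq']
  calc (q : ℝ) * |α - p / q| ≤ q * (1 / (q * Q)) := by gcongr
    _ = 1 / Q := by field_simp

variable {α : ℝ} {p : ℤ} {q : ℕ} {Q : ℝ} (hq : 0 < q) (hQ : 0 < Q)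
  (hα : |α - p / q| ≤ 1 / (q * Q)) {x : UnitAddCircle} (hx : 4 * (q : ℝ) ^ 2 ≤ ‖q • x‖ * Q)
include hq hQ hα hx

/-- Multiplying the orbit point by q moves q x only by j(qα), of norm at most q/Q ≤ ‖q x‖/2; the
factor 2 in Jordan's inequality absorbs the loss. -/
theorem norm_nsmul_div_le_absSinPi {j : ℕ} (hj : j < q) :
    ‖q • x‖ / q ≤ absSinPi (x + j • (α : UnitAddCircle)) := by
  have hq' : (1 : ℝ) ≤ q := by exact_mod_cast hq
  have hj' : (j : ℝ) ≤ q := by exact_mod_cast hj.le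
  have h1 := norm_nsmul_coe_le hq hα
  have h2 : ‖q • x‖ ≤ q * ‖x + j • (α : UnitAddCircle)‖ + q * (1 / Q) := by
    calc ‖q • x‖ = ‖q • (x + j • (α : UnitAddCircle)) - j • (q • (α : UnitAddCircle))‖ := by
          rw [smul_add, smul_comm q j, add_sub_cancel_right]
      _ ≤ ‖q • (x + j • (α : UnitAddCircle))‖ + ‖j • (q • (α : UnitAddCircle))‖ := norm_sub_le _ _
      _ ≤ q * ‖x + j • (α : UnitAddCircle)‖ + j * ‖q • (α : UnitAddCircle)‖ :=
          add_le_add norm_nsmul_le norm_nsmul_le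
      _ ≤ _ := by gcongr
  have h3 : (q : ℝ) * (1 / Q) ≤ ‖q • x‖ / 2 := by
    rw [mul_one_div, div_le_iff₀ hQ]
    nlinarith
  have h4 := two_mul_norm_le_absSinPi (x + j • (α : UnitAddCircle))
  rw [div_le_iff₀ (by linarith)]
  nlinarith

/-- For p/q in place of α the product is known exactly. Replacing p/q by α changes each factor by a
relative error at most η with q η ≤ 1/2, which by Bernoulli costs at most a factor 1/2 overall. -/
theorem prod_absSinPi_lower_bound (hpq : IsCoprime p (q : ℤ)) :
    (1 / 2) ^ q * ‖q • x‖ ≤ ∏ j ∈ Finset.range q, absSinPi (x + j • (α : UnitAddCircle)) := by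
  have hq' : (1 : ℝ) ≤ q := by exact_mod_cast hq
  have hq0 : (0 : ℝ) < q := by linarith
  set a := ‖q • x‖ with ha
  have ha0 : 0 < a := by
    by_contra h
    have : a * Q ≤ 0 := mul_nonpos_of_nonpos_of_nonneg (not_lt.1 h) hQ.le
    nlinarith
  -- This is the ratio of the absolute error π/Q ≤ 4/Q to the lower bound 2a/q for a factor at p/q.
  set η : ℝ := 2 * q / (a * Q) with hη
  have hη0 : 0 ≤ η := by positivity
  have hqη : q * η ≤ 1 / 2 := by
    rw [hη, ← mul_div_assoc, div_le_iff₀ (by positivity)]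
    nlinarith
  have hη1 : η ≤ 1 := by nlinarith
  set β : UnitAddCircle := ((p / q : ℝ) : UnitAddCircle) with hβ
  have hqβ : q • β = 0 := by
    rw [hβ, ← AddCircle.coe_nsmul, nsmul_eq_mul, mul_div_cancel₀ _ hq0.ne']
    exact (AddCircle.coe_eq_zero_iff (1 : ℝ)).2 ⟨p, by simp⟩
  have hfac : ∀ j ∈ Finset.range q,
      (1 - η) * absSinPi (x + j • β) ≤ absSinPi (x + j • (α : UnitAddCircle)) := by
    intro j hj
    have hj' : (j : ℝ) ≤ q := by exact_mod_cast (Finset.mem_range.1 hj).le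
    have h1 : 2 * a / q ≤ absSinPi (x + j • β) := by
      refine le_trans ?_ (two_mul_norm_le_absSinPi _)
      rw [mul_div_assoc]
      gcongr
      rw [div_le_iff₀ hq0, mul_comm]
      calc a = ‖q • (x + j • β)‖ := by rw [smul_add, smul_comm q j, hqβ, smul_zero, add_zero]
        _ ≤ _ := norm_nsmul_le
    have h2 : ‖(x + j • β) - (x + j • (α : UnitAddCircle))‖ ≤ 1 / Q := by
      rw [add_sub_add_left_eq_sub, ← smul_sub, hβ, ← AddCircle.coe_sub]
      calc _ ≤ j * ‖((p / q - α : ℝ) : UnitAddCircle)‖ := norm_nsmul_le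
        _ ≤ q * (1 / (q * Q)) := by
            gcongr
            refine (norm_coe_le_abs _).trans ?_
            rwa [abs_sub_comm]
        _ = 1 / Q := by field_simp
    have h3 := absSinPi_sub_le (x + j • β) (x + j • (α : UnitAddCircle))
    have h4 : Real.pi * ‖(x + j • β) - (x + j • (α : UnitAddCircle))‖ ≤ 4 * (1 / Q) :=
      mul_le_mul Real.pi_le_four h2 (norm_nonneg _) (by norm_num)
    have h5 : 4 * (1 / Q) ≤ η * absSinPi (x + j • β) := by
      calc 4 * (1 / Q) = η * (2 * a / q) := by rw [hη]; field_simp; ring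
        _ ≤ _ := by gcongr
    linarith
  have h6 := Finset.prod_le_prod (s := Finset.range q)
    (fun j _ => mul_nonneg (by linarith) (absSinPi_nonneg _)) hfac
  rw [Finset.prod_mul_distrib, Finset.prod_const, Finset.card_range] at h6
  have h7 : 1 / 2 ≤ (1 - η) ^ q := by
    have := one_add_mul_le_pow (a := -η) (by linarith) q
    rw [← sub_eq_add_neg] at this
    linarith
  have h8 := prod_two_mul_absSinPi hq hpq x
  rw [Finset.prod_mul_distrib, Finset.prod_const, Finset.card_range] at h8
  have h9 := two_mul_norm_le_absSinPi (q • x)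
  have h10 : ∏ j ∈ Finset.range q, absSinPi (x + j • β)
      = (1 / 2) ^ q * (2 * absSinPi (q • x)) := by
    rw [← h8, ← mul_assoc, ← mul_pow, ← hβ]
    norm_num
  refine le_trans ?_ h6
  rw [h10]
  have h11 : (0 : ℝ) < (1 / 2) ^ q := by positivity
  calc (1 / 2) ^ q * a ≤ 1 / 2 * ((1 / 2) ^ q * (2 * absSinPi (q • x))) := by nlinarith
    _ ≤ _ := by
      gcongr
      exact mul_nonneg h11.le (by linarith [absSinPi_nonneg (q • x)])

end Approximation

/-! ### Denominators of the convergents -/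

section ContinuedFraction

variable {α : ℝ} (hα : Irrational α)
include hα

theorem not_terminatedAt_of_irrational (n : ℕ) : ¬ (GenContFract.of α).TerminatedAt n := by
  intro h
  obtain ⟨r, hr⟩ := (GenContFract.terminates_iff_rat α).1 ⟨n, h⟩
  exact hα ⟨r, hr.symm⟩

theorem exists_int_nums_dens (n : ℕ) :
    (∃ a b : ℤ, (GenContFract.of α).nums n = a ∧ (GenContFract.of α).dens n = b) ∧
    ∃ a b : ℤ, (GenContFract.of α).nums (n + 1) = a ∧ (GenContFract.of α).dens (n + 1) = b := by
  have hs : ∀ k, ∃ gp, (GenContFract.of α).s.get? k = some gp ∧ gp.a = 1 ∧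
      ∃ c : ℤ, gp.b = c := by
    intro k
    obtain ⟨gp, hgp⟩ := Option.ne_none_iff_exists'.1 (not_terminatedAt_of_irrational hα k)
    exact ⟨gp, hgp, GenContFract.of_partNum_eq_one_and_exists_int_partDen_eq hgp⟩
  induction n with
  | zero =>
    obtain ⟨gp, hgp, ha, c, hc⟩ := hs 0
    refine ⟨⟨⌊α⌋, 1, by simp, by simp⟩, c * ⌊α⌋ + 1, c, ?_, ?_⟩
    · rw [GenContFract.first_num_eq hgp, ha, hc]; simp
    · rw [GenContFract.first_den_eq hgp, hc]
  | succ n ih =>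
    obtain ⟨⟨a, b, ha, hb⟩, a', b', ha', hb'⟩ := ih
    obtain ⟨gp, hgp, h1, c, hc⟩ := hs (n + 1)
    refine ⟨⟨a', b', ha', hb'⟩, c * a' + a, c * b' + b, ?_, ?_⟩
    · rw [GenContFract.nums_recurrence hgp ha ha', h1, hc]; push_cast; ring
    · rw [GenContFract.dens_recurrence hgp hb hb', h1, hc]; push_cast; ring

/-- The integer `dens` is a multiple of the reduced denominator. This one inequality suffices for
the approximation bound, so coprimality of the continuants is not needed. -/
theorem cfDen_le_dens (n : ℕ) : (cfDen α n : ℝ) ≤ (GenContFract.of α).dens n := by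
  obtain ⟨a, b, ha, hb⟩ := (exists_int_nums_dens hα n).1
  have h1 : (1 : ℝ) ≤ (GenContFract.of α).dens n := by
    have := GenContFract.succ_nth_fib_le_of_nth_den (v := α) (n := n)
      (Or.inr (not_terminatedAt_of_irrational hα _))
    exact le_trans (by exact_mod_cast Nat.fib_pos.2 n.succ_pos) this
  have hb0 : 0 < b := by
    rw [hb] at h1
    exact_mod_cast lt_of_lt_of_le one_pos h1
  have hconv : α.convergent n = (a : ℚ) / b := by
    have := Real.convs_eq_convergent α n
    rw [GenContFract.conv_eq_num_div_den, ha, hb] at this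
    exact_mod_cast this.symm
  have hdvd : ((α.convergent n).den : ℤ) ∣ b := by
    rw [hconv, ← Rat.divInt_eq_div]
    exact Rat.den_dvd a b
  rw [hb]
  exact_mod_cast Int.le_of_dvd hb0 hdvd

theorem abs_sub_convergent_le (n : ℕ) :
    |α - (α.convergent n).num / cfDen α n| ≤ 1 / (cfDen α n * cfDen α (n + 1)) := by
  have h := GenContFract.abs_sub_convs_le (not_terminatedAt_of_irrational hα n)
  rw [Real.convs_eq_convergent, Rat.cast_def] at h
  refine h.trans ?_
  have hpos : ∀ k, (0 : ℝ) < cfDen α k := fun k => by exact_mod_cast (α.convergent k).den_pos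
  have := hpos n
  have := hpos (n + 1)
  exact one_div_le_one_div_of_le (by positivity)
    (mul_le_mul (cfDen_le_dens hα n) (cfDen_le_dens hα _) (by positivity)
      (le_trans (by positivity) (cfDen_le_dens hα n)))

/-- Rationals of bounded denominator keep a positive distance from an irrational, whereas the
convergents converge to it. -/
theorem tendsto_cfDen : Tendsto (cfDen α) atTop atTop := by
  refine tendsto_atTop.2 fun B => ?_
  have h1 := hα.eventually_forall_le_dist_cast_rat_of_den_le B
  obtain ⟨ε, hε, hε0⟩ := ((h1.filter_mono nhdsWithin_le_nhds).and
    (self_mem_nhdsWithin (s := Set.Ioi (0 : ℝ)))).exists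
  have h2 := GenContFract.of_convergence α
  filter_upwards [Metric.tendsto_nhds.1 h2 ε hε0] with n hn
  by_contra hlt
  have := hε (α.convergent n) (not_le.1 hlt).le
  rw [Real.convs_eq_convergent, dist_comm] at hn
  linarith

end ContinuedFraction

theorem cfDen_pos (α : ℝ) (n : ℕ) : 0 < cfDen α n := (α.convergent n).den_pos

theorem isCoprime_num_cfDen (α : ℝ) (n : ℕ) :
    IsCoprime (α.convergent n).num (cfDen α n : ℤ) :=
  Int.isCoprime_iff_gcd_eq_one.2 (α.convergent n).reduced

/-! ### Weyl equidistribution for every starting point -/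

section Equidistribution

instance isProbabilityMeasure_unitAddCircle :
    IsProbabilityMeasure (volume : Measure UnitAddCircle) :=
  ⟨UnitAddCircle.measure_univ⟩

theorem fourier_coe_ne_one {α : ℝ} (hα : Irrational α) {m : ℤ} (hm : m ≠ 0) :
    fourier m (α : UnitAddCircle) ≠ 1 := by
  intro h
  rw [fourier_apply] at h
  have h1 : AddCircle.toCircle (m • (α : UnitAddCircle))
      = AddCircle.toCircle (0 : UnitAddCircle) := by
    rw [AddCircle.toCircle_zero]
    exact Subtype.ext h
  have h2 := AddCircle.injective_toCircle one_ne_zero h1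
  rw [← AddCircle.coe_zsmul, AddCircle.coe_eq_zero_iff] at h2
  obtain ⟨k, hk⟩ := h2
  rw [zsmul_eq_mul, zsmul_eq_mul, mul_one] at hk
  exact (hα.intCast_mul hm).ne_int k hk.symm

theorem fourier_add_point (m : ℤ) (x y : UnitAddCircle) :
    fourier m (x + y) = fourier m x * fourier m y := by
  simp only [fourier_apply, smul_add, AddCircle.toCircle_add, Circle.coe_mul]

theorem fourier_nsmul_point (m : ℤ) (k : ℕ) (y : UnitAddCircle) :
    fourier m (k • y) = fourier m y ^ k := by
  simp only [fourier_apply, smul_comm m k, AddCircle.toCircle_nsmul, Circle.coe_pow]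

/-- For a nontrivial character the orbit sum is geometric with ratio ≠ 1, hence bounded, and the
integral vanishes by translation invariance. -/
theorem tendsto_average_fourier {α : ℝ} (hα : Irrational α) (x : UnitAddCircle) (m : ℤ) :
    Tendsto (fun n : ℕ => (n : ℂ)⁻¹ * ∑ k ∈ Finset.range n,
      fourier m (x + k • (α : UnitAddCircle))) atTop (𝓝 (∫ y : UnitAddCircle, fourier m y)) := by
  rcases eq_or_ne m 0 with rfl | hm
  · simp only [fourier_zero, Finset.sum_const, Finset.card_range, nsmul_eq_mul, mul_one,
      integral_const, probReal_univ, one_smul]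
    refine tendsto_const_nhds.congr' ?_
    filter_upwards [eventually_ne_atTop 0] with n hn
    rw [inv_mul_cancel₀ (by exact_mod_cast hn)]
  · have hw := fourier_coe_ne_one hα hm
    set w := fourier m (α : UnitAddCircle) with hwdef
    have hint : ∫ y : UnitAddCircle, fourier m y = 0 := by
      have h1 := integral_add_right_eq_self (μ := (volume : Measure UnitAddCircle))
        (fun y => (fourier m y : ℂ)) (α : UnitAddCircle)
      simp only [fourier_add_point, integral_mul_const] at h1
      rw [← hwdef] at h1
      have h2 : (∫ y : UnitAddCircle, (fourier m y : ℂ)) * (w - 1) = 0 := by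
        rw [mul_sub, h1]; ring
      exact (mul_eq_zero.1 h2).resolve_right (sub_ne_zero.2 hw)
    rw [hint]
    have hnorm : ∀ z : UnitAddCircle, ‖(fourier m z : ℂ)‖ = 1 := fun z => by
      rw [fourier_apply, Circle.norm_coe]
    refine squeeze_zero_norm (a := fun n : ℕ => (n : ℝ)⁻¹ * (2 / ‖w - 1‖)) (fun n => ?_) ?_
    · simp only [fourier_add_point, fourier_nsmul_point, ← Finset.mul_sum, ← hwdef]
      rw [geom_sum_eq hw, norm_mul, norm_mul, hnorm, one_mul, norm_inv, Complex.norm_natCast,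
        norm_div]
      gcongr
      calc ‖w ^ n - 1‖ ≤ ‖w ^ n‖ + ‖(1 : ℂ)‖ := norm_sub_le _ _
        _ = 2 := by rw [norm_pow, hwdef, hnorm]; norm_num
    · simpa using (tendsto_inv_atTop_nhds_zero_nat (𝕜 := ℝ)).mul_const (2 / ‖w - 1‖)

theorem tendsto_average_complex {α : ℝ} (hα : Irrational α) (x : UnitAddCircle)
    (F : C(UnitAddCircle, ℂ)) :
    Tendsto (fun n : ℕ => (n : ℂ)⁻¹ * ∑ k ∈ Finset.range n, F (x + k • (α : UnitAddCircle)))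
      atTop (𝓝 (∫ y, F y)) := by
  have hI : ∀ G : C(UnitAddCircle, ℂ), Integrable (fun y => G y) volume := fun G =>
    G.continuous.integrable_of_hasCompactSupport (HasCompactSupport.of_compactSpace _)
  have hspan : ∀ G ∈ Submodule.span ℂ (Set.range (fourier (T := (1 : ℝ)))),
      Tendsto (fun n : ℕ => (n : ℂ)⁻¹ * ∑ k ∈ Finset.range n, G (x + k • (α : UnitAddCircle)))
        atTop (𝓝 (∫ y : UnitAddCircle, G y)) := by
    intro G hG
    induction hG using Submodule.span_induction with
    | mem G h =>
      obtain ⟨m, rfl⟩ := h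
      exact tendsto_average_fourier hα x m
    | zero => simp
    | add G H _ _ hG hH =>
      simp only [ContinuousMap.add_apply, Finset.sum_add_distrib, mul_add]
      rw [integral_add (hI G) (hI H)]
      exact hG.add hH
    | smul c G _ hG =>
      simp only [ContinuousMap.smul_apply, smul_eq_mul, ← Finset.mul_sum]
      rw [integral_const_mul]
      simpa only [mul_left_comm] using hG.const_mul c
  have hF : F ∈ (Submodule.span ℂ (Set.range (fourier (T := (1 : ℝ))))).topologicalClosure := by
    rw [span_fourier_closure_eq_top]; trivial
  rw [Metric.tendsto_nhds]
  intro ε hε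
  obtain ⟨G, hG, hFG⟩ := Metric.mem_closure_iff.1 hF (ε / 3) (by positivity)
  rw [dist_eq_norm] at hFG
  have hpt : ∀ y, ‖F y - G y‖ ≤ ε / 3 := fun y =>
    ((F - G).norm_coe_le_norm y).trans hFG.le
  filter_upwards [Metric.tendsto_nhds.1 (hspan G hG) (ε / 3) (by positivity)] with n hn
  have h1 : dist ((n : ℂ)⁻¹ * ∑ k ∈ Finset.range n, F (x + k • (α : UnitAddCircle)))
      ((n : ℂ)⁻¹ * ∑ k ∈ Finset.range n, G (x + k • (α : UnitAddCircle))) ≤ ε / 3 := by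
    rw [dist_eq_norm, ← mul_sub, ← Finset.sum_sub_distrib, norm_mul, norm_inv, Complex.norm_natCast]
    rcases Nat.eq_zero_or_pos n with rfl | hn0
    · simp; positivity
    · rw [inv_mul_le_iff₀ (by exact_mod_cast hn0)]
      refine (norm_sum_le_of_le _ fun k _ => hpt _).trans ?_
      simp
  have h2 : dist (∫ y, G y) (∫ y, F y) ≤ ε / 3 := by
    rw [dist_comm, dist_eq_norm, ← integral_sub (hI F) (hI G)]
    simpa using norm_integral_le_of_norm_le_const
      (μ := (volume : Measure UnitAddCircle)) (Eventually.of_forall hpt)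
  have h3 := dist_triangle4 ((n : ℂ)⁻¹ * ∑ k ∈ Finset.range n, F (x + k • (α : UnitAddCircle)))
    ((n : ℂ)⁻¹ * ∑ k ∈ Finset.range n, G (x + k • (α : UnitAddCircle))) (∫ y, G y) (∫ y, F y)
  linarith

theorem tendsto_average {α : ℝ} (hα : Irrational α) (x : UnitAddCircle)
    {φ : UnitAddCircle → ℝ} (hφ : Continuous φ) :
    Tendsto (fun n : ℕ => (n : ℝ)⁻¹ * ∑ k ∈ Finset.range n, φ (x + k • (α : UnitAddCircle)))
      atTop (𝓝 (∫ y, φ y)) := by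
  have h := tendsto_average_complex hα x ⟨fun y => (φ y : ℂ), by fun_prop⟩
  have h2 := (Complex.continuous_re.tendsto _).comp h
  simp only [ContinuousMap.coe_mk, integral_complex_ofReal, Complex.ofReal_re] at h2
  refine h2.congr fun n => ?_
  simp only [Function.comp_apply]
  rw [← Complex.ofReal_sum, ← Complex.ofReal_natCast, ← Complex.ofReal_inv, ← Complex.ofReal_mul,
    Complex.ofReal_re]

end Equidistribution

/-! ### Cocycles over a rotation and their uniform growth -/

/-- The iterates `B (x + (n - 1) a) * ⋯ * B (x + a) * B x` of the cocycle `(a, B)` over the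
rotation by `a`. -/
def cocycle {R : Type*} [Monoid R] {G : Type*} [AddMonoid G] (B : G → R) (a : G) : ℕ → G → R
  | 0, _ => 1
  | n + 1, x => B (x + n • a) * cocycle B a n x

section Cocycle

variable {R : Type*} {G : Type*} [AddCommGroup G]

@[simp] theorem cocycle_zero [Monoid R] (B : G → R) (a x : G) : cocycle B a 0 x = 1 := rfl

theorem cocycle_succ [Monoid R] (B : G → R) (a : G) (n : ℕ) (x : G) :
    cocycle B a (n + 1) x = B (x + n • a) * cocycle B a n x := rfl

theorem cocycle_add [Monoid R] (B : G → R) (a : G) (m n : ℕ) (x : G) :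
    cocycle B a (m + n) x = cocycle B a m (x + n • a) * cocycle B a n x := by
  induction m with
  | zero => simp
  | succ m ih =>
    rw [Nat.add_right_comm, cocycle_succ, ih, cocycle_succ, mul_assoc, add_smul]
    congr 2
    abel_nf

theorem continuous_cocycle [Monoid R] [TopologicalSpace R] [ContinuousMul R]
    [TopologicalSpace G] [ContinuousAdd G] {B : G → R} (hB : Continuous B) (a : G) (n : ℕ) :
    Continuous (cocycle B a n) := by
  induction n with
  | zero => exact continuous_const
  | succ n ih => exact (hB.comp (by fun_prop)).mul ih

theorem norm_cocycle_le [NormedRing R] [NormOneClass R] {B : G → R} {C : ℝ} (hC : 0 ≤ C)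
    (hB : ∀ x, ‖B x‖ ≤ C) (a : G) (n : ℕ) (x : G) : ‖cocycle B a n x‖ ≤ C ^ n := by
  induction n with
  | zero => simp
  | succ n ih =>
    rw [cocycle_succ, pow_succ']
    exact (norm_mul_le _ _).trans (mul_le_mul (hB _) ih (norm_nonneg _) hC)

/-- A telescoping sum: the j-th term has the factors after time j on the orbit of y and those before
it on the orbit of x. -/
theorem cocycle_sub_cocycle [Ring R] (B : G → R) (a x y : G) (n : ℕ) :
    cocycle B a n y - cocycle B a n x = ∑ j ∈ Finset.range n,
      cocycle B a (n - 1 - j) (y + (j + 1) • a) * (B (y + j • a) - B (x + j • a))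
        * cocycle B a j x := by
  induction n with
  | zero => simp
  | succ n ih =>
    rw [Finset.sum_range_succ]
    have h : ∀ j ∈ Finset.range n, cocycle B a (n + 1 - 1 - j) (y + (j + 1) • a)
        = B (y + n • a) * cocycle B a (n - 1 - j) (y + (j + 1) • a) := by
      intro j hj
      have hj := Finset.mem_range.1 hj
      rw [show n + 1 - 1 - j = (n - 1 - j) + 1 by omega, cocycle_succ, add_assoc, ← add_smul,
        show j + 1 + (n - 1 - j) = n by omega]
    rw [Finset.sum_congr rfl fun j hj => by
        rw [h j hj, mul_assoc, mul_assoc, ← mul_assoc (cocycle _ _ _ _)],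
      ← Finset.mul_sum, ← ih]
    simp only [Nat.add_sub_cancel, Nat.sub_self, cocycle_zero, one_mul, cocycle_succ]
    noncomm_ring

variable [NormedRing R] [NormOneClass R]

/-- Moving the window of N consecutive norms one step to the right trades ‖B_k‖ for ‖B_{k+N}‖ ≤
‖B_N(x + k a)‖ ‖B_k‖. All residues mod N are thereby treated at once. -/
theorem prod_norm_cocycle_le (B : G → R) (a x : G) (N k : ℕ) :
    ∏ i ∈ Finset.range N, ‖cocycle B a (k + i) x‖ ≤
      (∏ i ∈ Finset.range N, ‖cocycle B a i x‖)
        * ∏ i ∈ Finset.range k, ‖cocycle B a N (x + i • a)‖ := by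
  induction k with
  | zero => simp
  | succ k ih =>
    rw [Finset.prod_range_succ _ k, ← mul_assoc]
    rcases (norm_nonneg (cocycle B a k x)).eq_or_lt' with h0 | h0
    · rcases N.eq_zero_or_pos with rfl | hN
      · simp
      have hz : cocycle B a (k + 1 + 0) x = 0 := by
        rw [add_zero, cocycle_succ, norm_eq_zero.1 h0, mul_zero]
      rw [Finset.prod_eq_zero (Finset.mem_range.2 hN) (by rw [hz, norm_zero])]
      positivity
    · have h1 : (∏ i ∈ Finset.range N, ‖cocycle B a (k + 1 + i) x‖) * ‖cocycle B a k x‖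
          = (∏ i ∈ Finset.range N, ‖cocycle B a (k + i) x‖) * ‖cocycle B a (N + k) x‖ := by
        have := (Finset.prod_range_succ (fun i => ‖cocycle B a (k + i) x‖) N).symm.trans
          (Finset.prod_range_succ' (fun i => ‖cocycle B a (k + i) x‖) N)
        rw [add_comm N k, this, add_zero]
        simp only [add_assoc, add_comm 1]
      have h2 : ‖cocycle B a (N + k) x‖ ≤ ‖cocycle B a N (x + k • a)‖ * ‖cocycle B a k x‖ := by
        rw [cocycle_add]; exact norm_mul_le _ _
      refine le_of_mul_le_mul_right ?_ h0
      rw [h1]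
      calc _ ≤ (∏ i ∈ Finset.range N, ‖cocycle B a (k + i) x‖)
            * (‖cocycle B a N (x + k • a)‖ * ‖cocycle B a k x‖) := by gcongr
        _ ≤ ((∏ i ∈ Finset.range N, ‖cocycle B a i x‖)
            * ∏ i ∈ Finset.range k, ‖cocycle B a N (x + i • a)‖)
            * (‖cocycle B a N (x + k • a)‖ * ‖cocycle B a k x‖) := by gcongr
        _ = _ := by ring

/-- A uniform upper bound for the iterates of a bounded cocycle in terms of Birkhoff sums of
`log ‖B_N‖ / N`, truncated from below. -/
theorem exists_norm_cocycle_le_exp {B : G → R} {C : ℝ} (hB : ∀ x, ‖B x‖ ≤ C) (a : G) {N : ℕ}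
    (hN : 0 < N) {κ : ℝ} (hκ : 0 < κ) (hκ1 : κ ≤ 1) :
    ∃ K : ℝ, 1 ≤ K ∧ ∀ n x, ‖cocycle B a n x‖ ≤ K * Real.exp (∑ i ∈ Finset.range n,
      Real.log (max ‖cocycle B a N (x + i • a)‖ κ) / N) := by
  wlog hC : 1 ≤ C generalizing C
  · exact this (C := max C 1) (fun x => (hB x).trans (le_max_left _ _)) (le_max_right _ _)
  have hC0 : 0 ≤ C := by linarith
  have hN' : (0 : ℝ) < N := by exact_mod_cast hN
  set Φ : G → ℝ := fun y => max ‖cocycle B a N y‖ κ with hΦ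
  have hΦ0 : ∀ y, 0 < Φ y := fun y => lt_max_of_lt_right hκ
  -- One `C ^ (N * N)` pays for comparing the N-th power of the last norm with a window of N norms,
  -- the other for the initial window; `κ⁻¹ ^ N` pays for the at most N extra factors, each at least
  -- κ, that complete the product.
  set K₀ : ℝ := C ^ (N * N) * C ^ (N * N) * κ⁻¹ ^ N with hK₀
  have hκinv : 1 ≤ κ⁻¹ := (one_le_inv₀ hκ).2 hκ1
  have hK₀1 : 1 ≤ K₀ := one_le_mul_of_one_le_of_one_le
    (one_le_mul_of_one_le_of_one_le (one_le_pow₀ hC) (one_le_pow₀ hC)) (one_le_pow₀ hκinv)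
  have hκprod : ∀ s : Finset ℕ, ∀ x : G, s.card ≤ N → 1 ≤ κ⁻¹ ^ N * ∏ i ∈ s, Φ (x + i • a) := by
    intro s x hs
    have h1 : κ ^ s.card ≤ ∏ i ∈ s, Φ (x + i • a) := by
      rw [← Finset.prod_const]
      exact Finset.prod_le_prod (fun _ _ => hκ.le) fun i _ => le_max_right _ _
    calc (1 : ℝ) = κ⁻¹ ^ N * κ ^ N := by rw [← mul_pow, inv_mul_cancel₀ hκ.ne', one_pow]
      _ ≤ κ⁻¹ ^ N * κ ^ s.card := by
        gcongr ?_ * ?_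
        exact pow_le_pow_of_le_one hκ.le hκ1 hs
      _ ≤ _ := by gcongr
  have hmain : ∀ n x, ‖cocycle B a n x‖ ^ N ≤ K₀ * ∏ i ∈ Finset.range n, Φ (x + i • a) := by
    intro n x
    rcases le_total n N with hn | hn
    · have h1 : ‖cocycle B a n x‖ ^ N ≤ C ^ (N * N) := by
        rw [pow_mul]
        exact pow_le_pow_left₀ (norm_nonneg _)
          ((norm_cocycle_le hC0 hB a n x).trans (pow_le_pow_right₀ hC hn)) N
      calc ‖cocycle B a n x‖ ^ N ≤ C ^ (N * N) * 1 * 1 := by simpa using h1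
        _ ≤ C ^ (N * N) * C ^ (N * N) * (κ⁻¹ ^ N * ∏ i ∈ Finset.range n, Φ (x + i • a)) := by
          gcongr
          · exact one_le_pow₀ hC
          · exact hκprod _ x (by simpa using hn)
        _ = _ := by rw [hK₀]; ring
    · obtain ⟨k, rfl⟩ := Nat.exists_eq_add_of_le' hn
      have h1 : ‖cocycle B a (k + N) x‖ ^ N
          ≤ C ^ (N * N) * ∏ i ∈ Finset.range N, ‖cocycle B a (k + i) x‖ := by
        have h2 : ∀ i ∈ Finset.range N,
            ‖cocycle B a (k + N) x‖ ≤ C ^ N * ‖cocycle B a (k + i) x‖ := by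
          intro i hi
          have hi := Finset.mem_range.1 hi
          rw [show k + N = (N - i) + (k + i) by omega, cocycle_add]
          refine (norm_mul_le _ _).trans ?_
          gcongr
          exact (norm_cocycle_le hC0 hB a _ _).trans (pow_le_pow_right₀ hC (Nat.sub_le _ _))
        have h3 := Finset.prod_le_prod (fun _ _ => norm_nonneg _) h2
        rwa [Finset.prod_const, Finset.prod_mul_distrib, Finset.prod_const, Finset.card_range,
          ← pow_mul] at h3
      have h4 : ∏ i ∈ Finset.range N, ‖cocycle B a i x‖ ≤ C ^ (N * N) := by
        rw [pow_mul]
        calc _ ≤ ∏ _i ∈ Finset.range N, C ^ N :=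
              Finset.prod_le_prod (fun _ _ => norm_nonneg _) fun i hi =>
                (norm_cocycle_le hC0 hB a _ _).trans
                  (pow_le_pow_right₀ hC (Finset.mem_range.1 hi).le)
          _ = _ := by simp
      have h5 : ∏ i ∈ Finset.range k, ‖cocycle B a N (x + i • a)‖
          ≤ ∏ i ∈ Finset.range k, Φ (x + i • a) :=
        Finset.prod_le_prod (fun _ _ => norm_nonneg _) fun i _ => le_max_left _ _
      have h6 : 0 ≤ ∏ i ∈ Finset.range k, Φ (x + i • a) :=
        Finset.prod_nonneg fun i _ => (hΦ0 _).le
      have h7 : 1 ≤ κ⁻¹ ^ N * ∏ i ∈ Finset.range N, Φ (x + (k + i) • a) := by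
        have := hκprod (Finset.range N) (x + k • a) (by simp)
        simpa only [add_smul, add_assoc] using this
      calc ‖cocycle B a (k + N) x‖ ^ N
          ≤ C ^ (N * N) * ((∏ i ∈ Finset.range N, ‖cocycle B a i x‖)
            * ∏ i ∈ Finset.range k, ‖cocycle B a N (x + i • a)‖) :=
            h1.trans (by gcongr; exact prod_norm_cocycle_le B a x N k)
        _ ≤ C ^ (N * N) * (C ^ (N * N) * ∏ i ∈ Finset.range k, Φ (x + i • a)) := by gcongr
        _ = C ^ (N * N) * (C ^ (N * N) * ∏ i ∈ Finset.range k, Φ (x + i • a)) * 1 := by ring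
        _ ≤ C ^ (N * N) * (C ^ (N * N) * ∏ i ∈ Finset.range k, Φ (x + i • a))
            * (κ⁻¹ ^ N * ∏ i ∈ Finset.range N, Φ (x + (k + i) • a)) := by gcongr
        _ = _ := by rw [hK₀, Finset.prod_range_add]; ring
  refine ⟨K₀, hK₀1, fun n x => ?_⟩
  refine le_of_pow_le_pow_left₀ hN.ne' (by positivity) ?_
  rw [mul_pow, ← Real.exp_nat_mul, Finset.mul_sum, Real.exp_sum]
  refine (hmain n x).trans ?_
  have : ∏ i ∈ Finset.range n, Real.exp (N * (Real.log (max ‖cocycle B a N (x + i • a)‖ κ) / N))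
      = ∏ i ∈ Finset.range n, Φ (x + i • a) := by
    refine Finset.prod_congr rfl fun i _ => ?_
    rw [mul_div_cancel₀ _ hN'.ne']
    exact Real.exp_log (hΦ0 _)
  rw [this]
  gcongr
  exact le_self_pow₀ hK₀1 hN.ne'

end Cocycle

/-! ### Operator norm of 2 × 2 matrices -/

section MatrixNorm

/-- The adjugate is the transpose conjugated by the rotation through a right angle, which is
unitary. -/
theorem norm_adjugate_fin_two_le (M : Matrix (Fin 2) (Fin 2) ℝ) : ‖M.adjugate‖ ≤ ‖M‖ := by
  set J : Matrix (Fin 2) (Fin 2) ℝ := !![0, -1; 1, 0] with hJ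
  have hU : J ∈ unitary (Matrix (Fin 2) (Fin 2) ℝ) := by
    rw [Unitary.mem_iff, Matrix.star_eq_conjTranspose, hJ]
    constructor <;>
    · ext i j
      fin_cases i <;> fin_cases j <;> simp [Matrix.mul_apply, Fin.sum_univ_two]
  have h : M.adjugate = star J * star M * J := by
    rw [Matrix.adjugate_fin_two, hJ, Matrix.star_eq_conjTranspose, Matrix.star_eq_conjTranspose]
    ext i j
    fin_cases i <;> fin_cases j <;> simp [Matrix.mul_apply, Fin.sum_univ_two]
  have h1 := CStarRing.norm_of_mem_unitary hU
  rw [h]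
  calc _ ≤ ‖star J‖ * ‖star M‖ * ‖J‖ := norm_mul₃_le
    _ = ‖M‖ := by rw [norm_star, norm_star, h1]; ring

theorem one_le_norm_of_det_eq_one {M : Matrix (Fin 2) (Fin 2) ℝ} (hM : M.det = 1) :
    1 ≤ ‖M‖ := by
  have h : M * M.adjugate = 1 := by rw [Matrix.mul_adjugate, hM, one_smul]
  have h1 : (1 : ℝ) ≤ ‖M‖ * ‖M‖ := by
    calc (1 : ℝ) = ‖M * M.adjugate‖ := by rw [h, norm_one]
      _ ≤ ‖M‖ * ‖M.adjugate‖ := norm_mul_le _ _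
      _ ≤ _ := by gcongr; exact norm_adjugate_fin_two_le M
  nlinarith [norm_nonneg M]

end MatrixNorm

/-! ### The transfer cocycle and its regularisation -/

section Transfer

/-- The matrix `f(x) A(x)`, which has no singularities. -/
def regTransfer (f g : UnitAddCircle → ℝ) (E : ℝ) (x : UnitAddCircle) :
    Matrix (Fin 2) (Fin 2) ℝ :=
  !![E * f x - g x, -f x; f x, 0]

/-- The product of `f` over the first `n` points of the orbit of `x`. -/
def orbitProd (f : UnitAddCircle → ℝ) (a : UnitAddCircle) (n : ℕ) (x : UnitAddCircle) : ℝ :=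
  ∏ j ∈ Finset.range n, f (x + j • a)

variable {f g : UnitAddCircle → ℝ}

theorem transferIter_eq_cocycle (f g : UnitAddCircle → ℝ) (α E : ℝ) (n : ℕ) (x : UnitAddCircle) :
    transferIter f g α E n x = cocycle (transfer f g E) (α : UnitAddCircle) n x := by
  induction n with
  | zero => rfl
  | succ n ih => rw [transferIter, ih, cocycle_succ, orbit, natCast_zsmul]

theorem det_cocycle_transfer (f g : UnitAddCircle → ℝ) (E : ℝ) (a : UnitAddCircle) (n : ℕ)
    (x : UnitAddCircle) : (cocycle (transfer f g E) a n x).det = 1 := by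
  induction n with
  | zero => simp
  | succ n ih => rw [cocycle_succ, Matrix.det_mul, ih]; simp [transfer, Matrix.det_fin_two]

theorem regTransfer_eq_smul {x : UnitAddCircle} (hx : f x ≠ 0) (E : ℝ) :
    regTransfer f g E x = f x • transfer f g E x := by
  rw [regTransfer, transfer]
  ext i j
  fin_cases i <;> fin_cases j <;> simp
  field_simp

theorem cocycle_regTransfer_eq_smul (E : ℝ) (a : UnitAddCircle) (n : ℕ) {x : UnitAddCircle}
    (hx : ∀ j : ℕ, f (x + j • a) ≠ 0) :
    cocycle (regTransfer f g E) a n x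
      = orbitProd f a n x • cocycle (transfer f g E) a n x := by
  induction n with
  | zero => simp [orbitProd]
  | succ n ih =>
    rw [cocycle_succ, ih, regTransfer_eq_smul (hx n), cocycle_succ, smul_mul_smul_comm, orbitProd,
      orbitProd, Finset.prod_range_succ, mul_comm]

theorem continuous_regTransfer (hf : Continuous f) (hg : Continuous g) (E : ℝ) :
    Continuous (regTransfer f g E) := by
  refine continuous_matrix fun i j => ?_
  fin_cases i <;> fin_cases j <;> simp [regTransfer] <;> fun_prop

theorem exists_norm_le_of_continuous {B : Type*} [SeminormedAddCommGroup B]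
    {u : UnitAddCircle → B} (hu : Continuous u) : ∃ C : ℝ, 1 ≤ C ∧ ∀ x, ‖u x‖ ≤ C := by
  obtain ⟨C, hC⟩ := isCompact_univ.exists_bound_of_continuousOn hu.continuousOn
  exact ⟨max C 1, le_max_right _ _, fun x => (hC x trivial).trans (le_max_left _ _)⟩

end Transfer

/-! ### The integral of log |f| -/

section LogIntegral

variable {f g : UnitAddCircle → ℝ} {m : ℕ} {z : Fin m → UnitAddCircle} {τ : Fin m → ℝ}
  {F : UnitAddCircle → ℝ}

theorem log_abs_eq_of_factor (hfac : ∀ x, f x = F x * ∏ l, absSinPi (x - z l) ^ τ l)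
    {x : UnitAddCircle} (hx : f x ≠ 0) (hτ : ∀ l, 0 < τ l) :
    Real.log |f x| = Real.log |F x| + ∑ l, τ l * Real.log (absSinPi (x - z l)) := by
  rw [hfac] at hx
  have h1 := left_ne_zero_of_mul hx
  have h2 := right_ne_zero_of_mul hx
  have h3 : ∀ l ∈ Finset.univ, absSinPi (x - z l) ^ τ l ≠ 0 := Finset.prod_ne_zero_iff.1 h2
  rw [hfac, abs_mul, Real.log_mul (abs_ne_zero.2 h1) (abs_ne_zero.2 h2), Real.log_abs,
    Real.log_abs, Real.log_prod h3]
  congr 1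
  refine Finset.sum_congr rfl fun l hl => Real.log_rpow ?_ _
  refine (absSinPi_nonneg _).lt_of_ne' fun h0 => h3 l hl ?_
  rw [h0, Real.zero_rpow (hτ l).ne']

theorem ae_ne_zero_of_factor (hfac : ∀ x, f x = F x * ∏ l, absSinPi (x - z l) ^ τ l)
    (hF : ∀ x, F x ≠ 0) : ∀ᵐ x, f x ≠ 0 := by
  have hfin : Set.Finite {x | f x = 0} := by
    refine (Set.finite_range z).subset fun x hx => ?_
    rw [Set.mem_ofPred_eq, hfac] at hx
    obtain ⟨l, -, hl⟩ := Finset.prod_eq_zero_iff.1 ((mul_eq_zero.1 hx).resolve_left (hF x))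
    refine ⟨l, ?_⟩
    have h0 := (Real.rpow_eq_zero_iff_of_nonneg (absSinPi_nonneg _)).1 hl
    exact (sub_eq_zero.1 (absSinPi_eq_zero_iff.1 h0.1)).symm
  have : NullSingletonClass (volume : Measure UnitAddCircle) := ⟨fun x => by
    have h := AddCircle.volume_closedBall (T := 1) (x := x) 0
    rwa [Metric.closedBall_zero, mul_zero, min_eq_right zero_le_one, ENNReal.ofReal_zero] at h⟩
  exact compl_mem_ae_iff.2 (hfin.measure_zero volume)

theorem integrable_of_continuous {u : UnitAddCircle → ℝ} (hu : Continuous u) :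
    Integrable u volume :=
  hu.integrable_of_hasCompactSupport (HasCompactSupport.of_compactSpace _)

theorem continuous_log_abs (hFc : Continuous F) (hF : ∀ x, F x ≠ 0) :
    Continuous fun x => Real.log |F x| :=
  hFc.abs.log fun x => abs_ne_zero.2 (hF x)

theorem integral_log_abs_of_factor (hfac : ∀ x, f x = F x * ∏ l, absSinPi (x - z l) ^ τ l)
    (hτ : ∀ l, 0 < τ l) (hFc : Continuous F) (hF : ∀ x, F x ≠ 0) :
    Integrable (fun x => Real.log |f x|) volume ∧
      ∫ x, Real.log |f x| = (∫ x, Real.log |F x|) - (∑ l, τ l) * Real.log 2 := by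
  have hae : (fun x => Real.log |f x|) =ᵐ[volume]
      fun x => Real.log |F x| + ∑ l, τ l * Real.log (absSinPi (x - z l)) := by
    filter_upwards [ae_ne_zero_of_factor hfac hF] with x hx
    exact log_abs_eq_of_factor hfac hx hτ
  have h1 := integrable_of_continuous (continuous_log_abs hFc hF)
  have h2 : ∀ l ∈ Finset.univ,
      Integrable (fun x => τ l * Real.log (absSinPi (x - z l))) volume :=
    fun l _ => (integrable_log_absSinPi.1.comp_sub_right (z l)).const_mul _
  refine ⟨(h1.add (integrable_finsetSum _ h2)).congr hae.symm, ?_⟩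
  rw [integral_congr_ae hae, integral_add h1 (integrable_finsetSum _ h2), integral_finsetSum _ h2,
    sub_eq_add_neg, Finset.sum_mul, ← Finset.sum_neg_distrib]
  congr 1
  refine Finset.sum_congr rfl fun l _ => ?_
  rw [integral_const_mul, integral_sub_right_eq_self (fun x => Real.log (absSinPi x)),
    integrable_log_absSinPi.2, mul_neg]

end LogIntegral

/-! ### Existence of the Lyapunov exponent and a continuous growth rate -/

section Lyapunov

variable {f g : UnitAddCircle → ℝ}

theorem ae_orbit_ne_zero (h0 : ∀ᵐ x, f x ≠ 0) (a : UnitAddCircle) :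
    ∀ᵐ x, ∀ j : ℕ, f (x + j • a) ≠ 0 := by
  refine ae_all_iff.2 fun j => ?_
  have hmp := (measurePreserving_add_right (volume : Measure UnitAddCircle)
    (j • a)).quasiMeasurePreserving
  exact hmp.ae (p := fun y => f y ≠ 0) h0

theorem log_norm_cocycle_regTransfer (E : ℝ) (a : UnitAddCircle) (n : ℕ) {x : UnitAddCircle}
    (hx : ∀ j : ℕ, f (x + j • a) ≠ 0) :
    Real.log ‖cocycle (regTransfer f g E) a n x‖ = (∑ j ∈ Finset.range n, Real.log |f (x + j • a)|)
      + Real.log ‖cocycle (transfer f g E) a n x‖ := by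
  have h1 := one_le_norm_of_det_eq_one (det_cocycle_transfer f g E a n x)
  rw [cocycle_regTransfer_eq_smul E a n hx, norm_smul, orbitProd, Real.log_mul
    (norm_ne_zero_iff.2 (Finset.prod_ne_zero_iff.2 fun j _ => hx j)) (by linarith),
    Real.norm_eq_abs, Finset.abs_prod, Real.log_prod fun j _ => abs_ne_zero.2 (hx j)]

theorem integrable_sum_log_orbit (hlog : Integrable (fun x => Real.log |f x|) volume)
    (a : UnitAddCircle) (n : ℕ) :
    Integrable (fun x => ∑ j ∈ Finset.range n, Real.log |f (x + j • a)|) volume :=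
  integrable_finsetSum _ fun j _ => hlog.comp_add_right (j • a)

variable (hfc : Continuous f) (hgc : Continuous g) (h0 : ∀ᵐ x, f x ≠ 0)
  (hlog : Integrable (fun x => Real.log |f x|) volume) (E : ℝ) (a : UnitAddCircle)
include hfc hgc h0 hlog

/-- The determinant gives the lower bound 0, and the bounded regularised cocycle gives the upper
bound n log C minus an integrable Birkhoff sum of log |f|. -/
theorem integrable_log_norm_cocycle_transfer (n : ℕ) :
    Integrable (fun x => Real.log ‖cocycle (transfer f g E) a n x‖) volume := by
  have hreg := continuous_regTransfer hfc hgc E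
  obtain ⟨C, hC1, hC⟩ := exists_norm_le_of_continuous hreg
  have hsum := integrable_sum_log_orbit hlog a n
  have hae : (fun x => Real.log ‖cocycle (regTransfer f g E) a n x‖
      - ∑ j ∈ Finset.range n, Real.log |f (x + j • a)|) =ᵐ[volume]
      fun x => Real.log ‖cocycle (transfer f g E) a n x‖ := by
    filter_upwards [ae_orbit_ne_zero h0 a] with x hx
    rw [log_norm_cocycle_regTransfer E a n hx, add_sub_cancel_left]
  have hmeas : AEStronglyMeasurable
      (fun x => Real.log ‖cocycle (regTransfer f g E) a n x‖) volume :=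
    (Real.measurable_log.comp (continuous_cocycle hreg a n).norm.measurable).aestronglyMeasurable
  refine (((integrable_const (n * Real.log C)).sub hsum).mono'
    ((hmeas.sub hsum.1).congr hae) ?_)
  filter_upwards [ae_orbit_ne_zero h0 a] with x hx
  have h1 := one_le_norm_of_det_eq_one (det_cocycle_transfer f g E a n x)
  rw [Real.norm_of_nonneg (Real.log_nonneg h1)]
  have h2 := log_norm_cocycle_regTransfer (g := g) E a n hx
  have h3 : ‖cocycle (regTransfer f g E) a n x‖ ≠ 0 := by
    rw [cocycle_regTransfer_eq_smul E a n hx, norm_smul]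
    exact mul_ne_zero (norm_ne_zero_iff.2 (Finset.prod_ne_zero_iff.2 fun j _ => hx j))
      (by linarith)
  have h4 : Real.log ‖cocycle (regTransfer f g E) a n x‖ ≤ n * Real.log C := by
    rw [← Real.log_pow]
    exact Real.log_le_log (by positivity) (norm_cocycle_le (by linarith) hC a n x)
  simp only [Pi.sub_apply]
  linarith

theorem integral_log_norm_cocycle_regTransfer (n : ℕ) :
    Integrable (fun x => Real.log ‖cocycle (regTransfer f g E) a n x‖) volume ∧
    ∫ x, Real.log ‖cocycle (regTransfer f g E) a n x‖ =
      n * (∫ x, Real.log |f x|) + ∫ x, Real.log ‖cocycle (transfer f g E) a n x‖ := by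
  have hsum := integrable_sum_log_orbit hlog a n
  have hA := integrable_log_norm_cocycle_transfer hfc hgc h0 hlog E a n
  have hae : (fun x => Real.log ‖cocycle (regTransfer f g E) a n x‖) =ᵐ[volume]
      fun x => (∑ j ∈ Finset.range n, Real.log |f (x + j • a)|)
        + Real.log ‖cocycle (transfer f g E) a n x‖ := by
    filter_upwards [ae_orbit_ne_zero h0 a] with x hx
    exact log_norm_cocycle_regTransfer E a n hx
  refine ⟨(hsum.add hA).congr hae.symm, ?_⟩
  rw [integral_congr_ae hae, integral_add hsum hA,
    integral_finsetSum _ fun j _ => hlog.comp_add_right (j • a)]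
  simp only [integral_add_right_eq_self (fun x => Real.log |f x|), Finset.sum_const,
    Finset.card_range, nsmul_eq_mul]

theorem subadditive_integral_log_norm :
    Subadditive fun n => ∫ x, Real.log ‖cocycle (transfer f g E) a n x‖ := by
  intro k n
  have hA := integrable_log_norm_cocycle_transfer hfc hgc h0 hlog E a
  have hpos : ∀ j x, (0 : ℝ) < ‖cocycle (transfer f g E) a j x‖ := fun j x =>
    lt_of_lt_of_le one_pos (one_le_norm_of_det_eq_one (det_cocycle_transfer f g E a j x))
  beta_reduce
  rw [← integral_add_right_eq_self (fun x => Real.log ‖cocycle (transfer f g E) a k x‖) (n • a),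
    ← integral_add ((hA k).comp_add_right (n • a)) (hA n)]
  refine integral_mono (hA _) (((hA k).comp_add_right (n • a)).add (hA n)) fun x => ?_
  beta_reduce
  rw [← Real.log_mul (hpos _ _).ne' (hpos _ _).ne', cocycle_add]
  refine Real.log_le_log ?_ (norm_mul_le _ _)
  rw [← cocycle_add]
  exact hpos _ _

theorem tendsto_integral_log_norm_div :
    ∃ L : ℝ, 0 ≤ L ∧ Tendsto (fun n : ℕ => (∫ x, Real.log ‖cocycle (transfer f g E) a n x‖) / n)
      atTop (𝓝 L) := by
  have hnn : ∀ n : ℕ, 0 ≤ (∫ x, Real.log ‖cocycle (transfer f g E) a n x‖) / n := fun n =>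
    div_nonneg (integral_nonneg fun x => Real.log_nonneg
      (one_le_norm_of_det_eq_one (det_cocycle_transfer f g E a n x))) n.cast_nonneg
  have h := (subadditive_integral_log_norm hfc hgc h0 hlog E a).tendsto_lim
    ⟨0, by rintro _ ⟨n, rfl⟩; exact hnn n⟩
  exact ⟨_, ge_of_tendsto' h hnn, h⟩

/-- A uniform upper bound for the regularised cocycle, with a continuous rate whose mean
is close to the Lyapunov exponent of that cocycle. -/
theorem exists_continuous_rate {L : ℝ} (hL : Tendsto (fun n : ℕ =>
      (∫ x, Real.log ‖cocycle (transfer f g E) a n x‖) / n) atTop (𝓝 L)) {ε : ℝ} (hε : 0 < ε) :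
    ∃ (ψ : UnitAddCircle → ℝ) (K : ℝ), Continuous ψ ∧ 1 ≤ K ∧
      (∀ n x, ‖cocycle (regTransfer f g E) a n x‖
        ≤ K * Real.exp (∑ i ∈ Finset.range n, ψ (x + i • a))) ∧
      ∫ x, ψ x ≤ L + (∫ x, Real.log |f x|) + ε := by
  have hreg := continuous_regTransfer hfc hgc E
  obtain ⟨N, hN, hN0⟩ := ((hL.eventually_lt_const (show L < L + ε / 2 by linarith)).and
    (eventually_gt_atTop 0)).exists
  have hN' : (0 : ℝ) < N := by exact_mod_cast hN0
  set u : UnitAddCircle → ℝ := fun x => ‖cocycle (regTransfer f g E) a N x‖ with hu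
  have huc : Continuous u := (continuous_cocycle hreg a N).norm
  obtain ⟨hint, hval⟩ := integral_log_norm_cocycle_regTransfer hfc hgc h0 hlog E a N
  have hu0 : ∀ᵐ x, 0 < u x := by
    filter_upwards [ae_orbit_ne_zero h0 a] with x hx
    rw [hu]
    simp only
    rw [cocycle_regTransfer_eq_smul E a N hx, norm_smul]
    have := one_le_norm_of_det_eq_one (det_cocycle_transfer f g E a N x)
    exact mul_pos (norm_pos_iff.2 (Finset.prod_ne_zero_iff.2 fun j _ => hx j)) (by linarith)
  have hκ0 : ∀ k : ℕ, (0 : ℝ) < 1 / (k + 1) := fun k => by positivity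
  have hκ1 : ∀ k : ℕ, (1 : ℝ) / (k + 1) ≤ 1 := fun k => by
    rw [div_le_one (by positivity)]; linarith [(k.cast_nonneg : (0 : ℝ) ≤ k)]
  have hcont : ∀ k : ℕ, Continuous fun x => Real.log (max (u x) (1 / (k + 1))) := fun k =>
    (huc.max continuous_const).log fun x => (lt_max_of_lt_right (hκ0 k)).ne'
  have hlim : Tendsto (fun k : ℕ => ∫ x, Real.log (max (u x) (1 / (k + 1)))) atTop
      (𝓝 (∫ x, Real.log (u x))) := by
    -- The truncation levels are at most 1, so truncating never increases |log u|, which therefore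
    -- dominates.
    refine tendsto_integral_of_dominated_convergence (fun x => ‖Real.log (u x)‖)
      (fun k => (hcont k).aestronglyMeasurable) hint.norm (fun k => ?_) ?_
    · filter_upwards [hu0] with x hx
      rcases le_total (u x) (1 / (k + 1)) with h | h
      · rw [max_eq_right h, Real.norm_eq_abs, Real.norm_eq_abs,
          abs_of_nonpos (Real.log_nonpos (hκ0 k).le (hκ1 k)),
          abs_of_nonpos (Real.log_nonpos hx.le (h.trans (hκ1 k)))]
        exact neg_le_neg (Real.log_le_log hx h)
      · rw [max_eq_left h]
    · filter_upwards [hu0] with x hx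
      have h1 : Tendsto (fun k : ℕ => max (u x) (1 / ((k : ℝ) + 1))) atTop (𝓝 (max (u x) 0)) :=
        tendsto_const_nhds.max tendsto_one_div_add_atTop_nhds_zero_nat
      rw [max_eq_left hx.le] at h1
      exact h1.log hx.ne'
  obtain ⟨k, hk⟩ := (hlim.eventually_lt_const (show ∫ x, Real.log (u x) <
    (∫ x, Real.log (u x)) + N * (ε / 2) by linarith [mul_pos hN' (half_pos hε)])).exists
  obtain ⟨C, -, hC⟩ := exists_norm_le_of_continuous hreg
  obtain ⟨K, hK1, hK⟩ := exists_norm_cocycle_le_exp hC a hN0 (hκ0 k) (hκ1 k)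
  refine ⟨fun x => Real.log (max (u x) (1 / (k + 1))) / N, K, (hcont k).div_const _, hK1, hK, ?_⟩
  rw [integral_div, div_le_iff₀ hN']
  rw [div_lt_iff₀ hN'] at hN
  rw [hu] at hk
  simp only at hk
  rw [hval] at hk
  nlinarith

end Lyapunov

/-! ### Small divisors and the index δ -/

section SmallDivisor

/-- The product of the small divisors `‖q (θ - z l)‖ ^ τ l`. -/
noncomputable def smallDivisor {m : ℕ} (z : Fin m → UnitAddCircle) (τ : Fin m → ℝ)
    (θ : UnitAddCircle) (q : ℕ) : ℝ :=
  ∏ l, ‖q • (θ - z l)‖ ^ τ l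

variable {m : ℕ} {z : Fin m → UnitAddCircle} {τ : Fin m → ℝ} {θ : UnitAddCircle}

theorem smallDivisor_nonneg (q : ℕ) : 0 ≤ smallDivisor z τ θ q :=
  Finset.prod_nonneg fun _ _ => Real.rpow_nonneg (norm_nonneg _) _

theorem tauMin_le_base (τ₀ : ℝ≥0) (τ : Fin m → ℝ) : tauMin τ₀ τ ≤ τ₀ :=
  (Finset.fold_min_le _).2 (Or.inl le_rfl)

theorem tauMin_le (τ₀ : ℝ≥0) (τ : Fin m → ℝ) (l : Fin m) : tauMin τ₀ τ ≤ τ l :=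
  (Finset.fold_min_le _).2 (Or.inr ⟨l, Finset.mem_univ l, le_rfl⟩)

theorem unitAddCircle_norm_le_one (x : UnitAddCircle) : ‖x‖ ≤ 1 := by
  have := AddCircle.norm_le_half_period (1 : ℝ) (x := x) one_ne_zero
  rw [abs_one] at this
  exact this.trans (by norm_num)

theorem coe_real_finset_sum {ι : Type*} (s : Finset ι) (u : ι → ℝ) :
    ((∑ i ∈ s, u i : ℝ) : EReal) = ∑ i ∈ s, (u i : EReal) :=
  map_sum (⟨⟨((↑) : ℝ → EReal), EReal.coe_zero⟩, EReal.coe_add⟩ : ℝ →+ EReal) u s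

theorem exp_le_smallDivisor_mul_rpow {q : ℕ} (hq : 0 < q) (hτ : ∀ l, 0 < τ l) {Q : ℝ}
    (hQ : 0 < Q) {c t : ℝ}
    (h : (c : EReal) < ((∑ l, (τ l : EReal) * ENNReal.log ‖q • (θ - z l)‖ₑ)
      + ((t * Real.log Q : ℝ) : EReal)) / ((q : ℝ) : EReal)) :
    Real.exp (c * q) ≤ smallDivisor z τ θ q * Q ^ t := by
  have hq' : (0 : ℝ) < q := by exact_mod_cast hq
  rw [EReal.lt_div_iff (by exact_mod_cast hq') (EReal.coe_ne_top _), ← EReal.coe_mul] at h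
  -- A vanishing distance would make the whole extended sum `⊥`, which exceeds no real number.
  have hpos : ∀ l, 0 < ‖q • (θ - z l)‖ := by
    intro l
    by_contra h0
    have h1 : ‖q • (θ - z l)‖ₑ = 0 := by
      rw [enorm_eq_zero]
      exact norm_le_zero_iff.1 (not_lt.1 h0)
    rw [← Finset.add_sum_erase _ _ (Finset.mem_univ l), h1, ENNReal.log_zero,
      EReal.coe_mul_bot_of_pos (hτ l), EReal.bot_add, EReal.bot_add] at h
    exact not_lt_bot h
  have hlog : ∀ l ∈ Finset.univ, (τ l : EReal) * ENNReal.log ‖q • (θ - z l)‖ₑ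
      = ((τ l * Real.log ‖q • (θ - z l)‖ : ℝ) : EReal) := by
    intro l _
    rw [← ofReal_norm, ENNReal.log_ofReal_of_pos (hpos l), EReal.coe_mul]
  rw [Finset.sum_congr rfl hlog, ← coe_real_finset_sum, ← EReal.coe_add, EReal.coe_lt_coe_iff] at h
  have hG : smallDivisor z τ θ q = Real.exp (∑ l, τ l * Real.log ‖q • (θ - z l)‖) := by
    rw [Real.exp_sum]
    exact Finset.prod_congr rfl fun l _ => by rw [Real.rpow_def_of_pos (hpos l), mul_comm]
  rw [hG, Real.rpow_def_of_pos hQ, ← Real.exp_add, mul_comm (Real.log Q)]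
  exact Real.exp_le_exp.2 h.le

/-- All other factors are at most 1, so exp(cq) ≤ (aQ)^τ_l with a = ‖q(θ - z l)‖. This forces aQ ≥
1, and then τ_l ≤ 1 allows the exponent to be dropped. -/
theorem exp_le_norm_mul {q : ℕ} (hτ : ∀ l, 0 < τ l) (hτ1 : ∀ l, τ l ≤ 1) {Q : ℝ} (hQ : 1 ≤ Q)
    {c t : ℝ} (hc : 0 ≤ c) (ht : ∀ l, t ≤ τ l)
    (h : Real.exp (c * q) ≤ smallDivisor z τ θ q * Q ^ t) (l : Fin m) :
    Real.exp (c * q) ≤ ‖q • (θ - z l)‖ * Q := by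
  set a := ‖q • (θ - z l)‖ with ha
  have h1 : smallDivisor z τ θ q ≤ a ^ τ l := by
    rw [smallDivisor, ← Finset.mul_prod_erase _ _ (Finset.mem_univ l)]
    refine mul_le_of_le_one_right (Real.rpow_nonneg (norm_nonneg _) _)
      (Finset.prod_le_one (fun _ _ => Real.rpow_nonneg (norm_nonneg _) _) fun i _ =>
        Real.rpow_le_one (norm_nonneg _) (unitAddCircle_norm_le_one _) (hτ i).le)
  have h2 : Real.exp (c * q) ≤ (a * Q) ^ τ l := by
    rw [Real.mul_rpow (norm_nonneg _) (by linarith)]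
    refine h.trans (mul_le_mul h1 (Real.rpow_le_rpow_of_exponent_le hQ (ht l))
      (by positivity) (by positivity))
  have h3 : 1 ≤ Real.exp (c * q) := Real.one_le_exp (by positivity)
  have h4 : 1 ≤ a * Q := by
    by_contra hlt
    have := Real.rpow_lt_one (z := τ l) (by positivity) (not_le.1 hlt) (hτ l)
    linarith
  exact h2.trans (Real.rpow_le_self_of_one_le h4 (hτ1 l))

end SmallDivisor

/-! ### Products of f along the orbit and stability under a shift -/

section OrbitProduct

variable {f : UnitAddCircle → ℝ} {m : ℕ} {z : Fin m → UnitAddCircle} {τ : Fin m → ℝ}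
  {F : UnitAddCircle → ℝ} (hfac : ∀ x, f x = F x * ∏ l, absSinPi (x - z l) ^ τ l)
  (hτ : ∀ l, 0 < τ l) (hτ1 : ∀ l, τ l ≤ 1)
  {α : ℝ} {p : ℤ} {q : ℕ} {Q : ℝ} (hq : 0 < q) (hQ : 0 < Q) (hα : |α - p / q| ≤ 1 / (q * Q))
  {θ : UnitAddCircle} (hres : ∀ l, 4 * (q : ℝ) ^ 2 ≤ ‖q • (θ - z l)‖ * Q)
include hfac hτ hq hQ hα hres

include hτ1 in
theorem smallDivisor_div_le_abs {c₀ : ℝ} (hF : ∀ x, c₀ ≤ |F x|) {j : ℕ}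
    (hj : j < q) :
    c₀ * (smallDivisor z τ θ q / (q : ℝ) ^ m) ≤ |f (θ + j • (α : UnitAddCircle))| := by
  have hq' : (1 : ℝ) ≤ q := by exact_mod_cast hq
  rw [hfac, abs_mul]
  refine mul_le_mul (hF _) ?_ (div_nonneg (smallDivisor_nonneg q) (by positivity)) (abs_nonneg _)
  rw [Finset.abs_prod, smallDivisor, show (q : ℝ) ^ m = ∏ _l : Fin m, (q : ℝ) by simp,
    ← Finset.prod_div_distrib]
  refine Finset.prod_le_prod (fun l _ => by positivity) fun l _ => ?_
  rw [abs_of_nonneg (Real.rpow_nonneg (absSinPi_nonneg _) _)]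
  have h1 := norm_nsmul_div_le_absSinPi hq hQ hα (hres l) hj
  rw [sub_add_eq_add_sub] at h1
  calc ‖q • (θ - z l)‖ ^ τ l / q ≤ ‖q • (θ - z l)‖ ^ τ l / (q : ℝ) ^ τ l := by
        gcongr
        exact Real.rpow_le_self_of_one_le hq' (hτ1 l)
    _ = (‖q • (θ - z l)‖ / q) ^ τ l := (Real.div_rpow (norm_nonneg _) (by linarith) _).symm
    _ ≤ _ := Real.rpow_le_rpow (by positivity) h1 (hτ l).le

/-- The sine product bound is raised to the power τ_l for each l. The sum of log |F| is kept as it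
is, since F is continuous and bounded away from zero in the application and equidistribution then
applies at every θ. -/
theorem orbitProd_lower_bound (hpq : IsCoprime p (q : ℤ)) (hF : ∀ x, F x ≠ 0) :
    Real.exp ((∑ j ∈ Finset.range q, Real.log |F (θ + j • (α : UnitAddCircle))|)
      - q * ((∑ l, τ l) * Real.log 2)) * smallDivisor z τ θ q
      ≤ |orbitProd f (α : UnitAddCircle) q θ| := by
  have h1 : |orbitProd f (α : UnitAddCircle) q θ|
      = (∏ j ∈ Finset.range q, |F (θ + j • (α : UnitAddCircle))|)
        * ∏ l, (∏ j ∈ Finset.range q, absSinPi (θ - z l + j • (α : UnitAddCircle))) ^ τ l := by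
    rw [orbitProd, Finset.abs_prod]
    simp_rw [hfac, abs_mul, Finset.abs_prod, Finset.prod_mul_distrib]
    rw [Finset.prod_comm]
    congr 1
    refine Finset.prod_congr rfl fun l _ => ?_
    rw [← Real.finsetProd_rpow _ _ fun j _ => absSinPi_nonneg _]
    refine Finset.prod_congr rfl fun j _ => ?_
    rw [abs_of_nonneg (Real.rpow_nonneg (absSinPi_nonneg _) _), sub_add_eq_add_sub]
  have h2 : Real.exp (∑ j ∈ Finset.range q, Real.log |F (θ + j • (α : UnitAddCircle))|)
      = ∏ j ∈ Finset.range q, |F (θ + j • (α : UnitAddCircle))| := by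
    rw [Real.exp_sum]
    exact Finset.prod_congr rfl fun j _ => Real.exp_log (abs_pos.2 (hF _))
  have h3 : Real.exp (-(q * ((∑ l, τ l) * Real.log 2)))
      = ∏ l, (((1 : ℝ) / 2) ^ q) ^ τ l := by
    rw [Finset.sum_mul, Finset.mul_sum, ← Finset.sum_neg_distrib, Real.exp_sum]
    refine Finset.prod_congr rfl fun l _ => ?_
    rw [Real.rpow_def_of_pos (by positivity), Real.log_pow, one_div, Real.log_inv]
    ring_nf
  rw [h1, sub_eq_add_neg, Real.exp_add, h2, h3, mul_assoc, smallDivisor,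
    ← Finset.prod_mul_distrib]
  gcongr with l
  rw [← Real.mul_rpow (by positivity) (norm_nonneg _)]
  exact Real.rpow_le_rpow (by positivity)
    (prod_absSinPi_lower_bound hq hQ hα (hres l) hpq) (hτ l).le

end OrbitProduct

theorem abs_orbitProd_add_le {f : UnitAddCircle → ℝ} {a θ b : UnitAddCircle} {q : ℕ} {κ ρ : ℝ}
    (hκ : 0 < κ) (hlow : ∀ j < q, κ ≤ |f (θ + j • a)|) (hρ : 0 ≤ ρ)
    (hb : ∀ x, |f (x + b) - f x| ≤ ρ) :
    |orbitProd f a q (θ + b)| ≤ |orbitProd f a q θ| * Real.exp (q * (ρ / κ)) := by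
  rw [orbitProd, orbitProd, Finset.abs_prod, Finset.abs_prod]
  calc ∏ j ∈ Finset.range q, |f (θ + b + j • a)|
      ≤ ∏ j ∈ Finset.range q, |f (θ + j • a)| * Real.exp (ρ / κ) := by
        refine Finset.prod_le_prod (fun _ _ => abs_nonneg _) fun j hj => ?_
        have h1 := hlow j (Finset.mem_range.1 hj)
        have h2 := hb (θ + j • a)
        rw [add_right_comm]
        have h3 : |f (θ + j • a + b)| ≤ |f (θ + j • a)| + ρ := by
          have := abs_sub_abs_le_abs_sub (f (θ + j • a + b)) (f (θ + j • a))
          linarith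
        have h4 : ρ ≤ |f (θ + j • a)| * (ρ / κ) := by
          calc ρ = κ * (ρ / κ) := by field_simp
            _ ≤ _ := by gcongr
        have h5 := Real.add_one_le_exp (ρ / κ)
        nlinarith [abs_nonneg (f (θ + j • a))]
    _ = _ := by
        rw [Finset.prod_mul_distrib, Finset.prod_const, Finset.card_range, ← Real.exp_nat_mul]

/-- In each telescoping term the two outer blocks carry all of the Birkhoff sum of ψ except its j-th
entry, which costs exp Cψ; passing back from the shifted points costs η per step. -/
theorem norm_cocycle_add_sub_le {R G : Type*} [NormedRing R] [AddCommGroup G] {B : G → R}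
    {a θ b : G} {ψ : G → ℝ} {K Cψ η ρ : ℝ} (hK : 1 ≤ K) (hη : 0 ≤ η) (hCψ : ∀ x, |ψ x| ≤ Cψ)
    (hB : ∀ n x, ‖cocycle B a n x‖ ≤ K * Real.exp (∑ i ∈ Finset.range n, ψ (x + i • a)))
    (hψ : ∀ x, ψ (x + b) - ψ x ≤ η) (hρ : ∀ x, ‖B (x + b) - B x‖ ≤ ρ) (q : ℕ) :
    ‖cocycle B a q (θ + b) - cocycle B a q θ‖ ≤ q * (K ^ 2 * ρ * Real.exp Cψ)
      * Real.exp ((∑ i ∈ Finset.range q, ψ (θ + i • a)) + q * η) := by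
  have hρ0 : 0 ≤ ρ := (norm_nonneg _).trans (hρ θ)
  rw [cocycle_sub_cocycle]
  have hterm : ∀ j ∈ Finset.range q,
      ‖cocycle B a (q - 1 - j) (θ + b + (j + 1) • a) * (B (θ + b + j • a) - B (θ + j • a))
        * cocycle B a j θ‖ ≤ (K ^ 2 * ρ * Real.exp Cψ)
      * Real.exp ((∑ i ∈ Finset.range q, ψ (θ + i • a)) + q * η) := by
    intro j hj
    have hj := Finset.mem_range.1 hj
    have h1 := hB (q - 1 - j) (θ + b + (j + 1) • a)
    have h2 := hB j θ
    have h3 : ‖B (θ + b + j • a) - B (θ + j • a)‖ ≤ ρ := by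
      rw [add_right_comm]; exact hρ _
    have h4 : ∑ i ∈ Finset.range (q - 1 - j), ψ (θ + b + (j + 1) • a + i • a)
        ≤ (∑ i ∈ Finset.range (q - 1 - j), ψ (θ + (j + 1 + i) • a)) + q * η := by
      have h5 : ∀ i ∈ Finset.range (q - 1 - j), ψ (θ + b + (j + 1) • a + i • a)
          ≤ ψ (θ + (j + 1 + i) • a) + η := by
        intro i _
        have := hψ (θ + (j + 1 + i) • a)
        rw [add_assoc (θ + b), ← add_smul, add_right_comm]
        linarith
      refine (Finset.sum_le_sum h5).trans ?_
      rw [Finset.sum_add_distrib, Finset.sum_const, Finset.card_range, nsmul_eq_mul]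
      gcongr
      omega
    have h6 : (∑ i ∈ Finset.range q, ψ (θ + i • a)) = (∑ i ∈ Finset.range j, ψ (θ + i • a))
        + ψ (θ + j • a) + ∑ i ∈ Finset.range (q - 1 - j), ψ (θ + (j + 1 + i) • a) := by
      conv_lhs => rw [show q = (j + 1) + (q - 1 - j) by omega]
      rw [Finset.sum_range_add, Finset.sum_range_succ]
    have h7 := (abs_le.1 (hCψ (θ + j • a))).1
    calc _ ≤ ‖cocycle B a (q - 1 - j) (θ + b + (j + 1) • a)‖
          * ‖B (θ + b + j • a) - B (θ + j • a)‖ * ‖cocycle B a j θ‖ := norm_mul₃_le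
      _ ≤ (K * Real.exp (∑ i ∈ Finset.range (q - 1 - j), ψ (θ + b + (j + 1) • a + i • a)))
          * ρ * (K * Real.exp (∑ i ∈ Finset.range j, ψ (θ + i • a))) := by gcongr
      _ = K ^ 2 * ρ * Real.exp ((∑ i ∈ Finset.range (q - 1 - j),
          ψ (θ + b + (j + 1) • a + i • a)) + ∑ i ∈ Finset.range j, ψ (θ + i • a)) := by
          rw [Real.exp_add]; ring
      _ ≤ K ^ 2 * ρ * Real.exp (Cψ + ((∑ i ∈ Finset.range q, ψ (θ + i • a)) + q * η)) := by
          exact mul_le_mul_of_nonneg_left (Real.exp_le_exp.2 (by linarith)) (by positivity)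
      _ = _ := by rw [Real.exp_add Cψ]; ring
  refine (norm_sum_le_of_le _ hterm).trans_eq ?_
  rw [Finset.sum_const, Finset.card_range, nsmul_eq_mul, mul_assoc]
  ring

/-! ### Gordon's lemma from Cayley–Hamilton -/

section Gordon

theorem adjugate_fin_two_sub (M N : Matrix (Fin 2) (Fin 2) ℝ) :
    (M - N).adjugate = M.adjugate - N.adjugate := by
  simp only [Matrix.adjugate_fin_two]
  ext i j
  fin_cases i <;> fin_cases j <;> simp <;> ring

theorem adjugate_fin_two_smul (r : ℝ) (M : Matrix (Fin 2) (Fin 2) ℝ) :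
    (r • M).adjugate = r • M.adjugate := by
  simp [Matrix.adjugate_smul]

/-- If W ≠ 0, the first two limits force tr M → 0; then W = tr(M) M W - M² W tends to 0, a
contradiction. -/
theorem eq_zero_of_tendsto_mul {ι : Type*} {l : Filter ι} [l.NeBot]
    {M : ι → Matrix (Fin 2) (Fin 2) ℝ} {W : Matrix (Fin 2) (Fin 2) ℝ} (hdet : ∀ i, (M i).det = 1)
    (h1 : Tendsto (fun i => M i * W) l (𝓝 0))
    (h2 : Tendsto (fun i => (M i).adjugate * W) l (𝓝 0))
    (h3 : Tendsto (fun i => M i * (M i * W)) l (𝓝 0)) : W = 0 := by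
  have htr : ∀ i (V : Matrix (Fin 2) (Fin 2) ℝ),
      M i * V + (M i).adjugate * V = (M i).trace • V := by
    intro i V
    rw [← add_mul]
    have : M i + (M i).adjugate = (M i).trace • 1 := by
      rw [Matrix.adjugate_fin_two, Matrix.trace_fin_two]
      ext a b
      fin_cases a <;> fin_cases b <;> simp [add_comm]
    rw [this, smul_mul_assoc, one_mul]
  by_contra hW
  have h4 : Tendsto (fun i => (M i).trace • W) l (𝓝 0) := by
    simpa only [htr, add_zero] using h1.add h2
  have h5 : Tendsto (fun i => (M i).trace) l (𝓝 0) := by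
    rw [tendsto_zero_iff_norm_tendsto_zero] at h4 ⊢
    simp only [norm_smul] at h4
    have := h4.mul_const ‖W‖⁻¹
    rw [zero_mul] at this
    refine this.congr fun i => ?_
    rw [mul_assoc, mul_inv_cancel₀ (norm_ne_zero_iff.2 hW), mul_one]
  have h6 : ∀ i, (M i).trace • (M i * W) - M i * (M i * W) = W := by
    intro i
    rw [← htr, add_sub_cancel_left, ← mul_assoc, Matrix.adjugate_mul, hdet, one_smul, one_mul]
  have h7 := (h5.smul h1).sub h3
  simp only [h6, smul_zero, sub_zero] at h7
  exact hW (tendsto_nhds_unique tendsto_const_nhds h7)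

end Gordon

/-! ### Comparison of θ with θ ± q α along good denominators -/

section ShiftEstimates

theorem tendsto_pow_mul_exp_neg {b : ℝ} (hb : 0 < b) (k : ℕ) :
    Tendsto (fun x : ℝ => x ^ k * Real.exp (-(b * x))) atTop (𝓝 0) := by
  refine (isLittleO_pow_exp_pos_mul_atTop k hb).tendsto_div_nhds_zero.congr fun x => ?_
  rw [Real.exp_neg, div_eq_mul_inv]

theorem abs_add_sub_le_of_holderWith {C τ₀ : ℝ≥0} {f : UnitAddCircle → ℝ}
    (hf : HolderWith C τ₀ f)
    (x b : UnitAddCircle) : |f (x + b) - f x| ≤ C * ‖b‖ ^ (τ₀ : ℝ) := by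
  have := hf.dist_le (x + b) x
  rwa [Real.dist_eq, dist_eq_norm, add_sub_cancel_left] at this

theorem norm_regTransfer_add_sub_le {Cf Cg τ₀ : ℝ≥0} {f g : UnitAddCircle → ℝ}
    (hf : HolderWith Cf τ₀ f) (hg : HolderWith Cg τ₀ g) (E : ℝ) (x b : UnitAddCircle) :
    ‖regTransfer f g E (x + b) - regTransfer f g E x‖ ≤
      (Cf * ‖(!![E, -1; 1, 0] : Matrix (Fin 2) (Fin 2) ℝ)‖
        + Cg * ‖(!![-1, 0; 0, 0] : Matrix (Fin 2) (Fin 2) ℝ)‖) * ‖b‖ ^ (τ₀ : ℝ) := by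
  have h : regTransfer f g E (x + b) - regTransfer f g E x
      = (f (x + b) - f x) • (!![E, -1; 1, 0] : Matrix (Fin 2) (Fin 2) ℝ)
        + (g (x + b) - g x) • (!![-1, 0; 0, 0] : Matrix (Fin 2) (Fin 2) ℝ) := by
    ext i j
    fin_cases i <;> fin_cases j <;> simp [regTransfer] <;> ring
  rw [h]
  refine (norm_add_le _ _).trans ?_
  rw [norm_smul, norm_smul, Real.norm_eq_abs, Real.norm_eq_abs, add_mul, mul_right_comm,
    mul_right_comm (Cg : ℝ)]
  gcongr
  · exact abs_add_sub_le_of_holderWith hf x b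
  · exact abs_add_sub_le_of_holderWith hg x b

variable {f : UnitAddCircle → ℝ} {m : ℕ} {z : Fin m → UnitAddCircle} {τ : Fin m → ℝ}
  {F : UnitAddCircle → ℝ} (hfac : ∀ x, f x = F x * ∏ l, absSinPi (x - z l) ^ τ l)
  (hτ : ∀ l, 0 < τ l) (hτ1 : ∀ l, τ l ≤ 1) {c₀ : ℝ} (hc₀ : 0 < c₀) (hF : ∀ x, c₀ ≤ |F x|)
  {α : ℝ} (hα : Irrational α) {θ : UnitAddCircle} {c s t : ℝ} (hc : 0 < c)
  (hts : t ≤ s) (htτ : ∀ l, t ≤ τ l) {l : Filter ℕ} (hl : l ≤ atTop)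
  (hres : ∀ᶠ n in l, Real.exp (c * cfDen α n)
    ≤ smallDivisor z τ θ (cfDen α n) * (cfDen α (n + 1) : ℝ) ^ t)
  {b : ℕ → UnitAddCircle} (hb : ∀ n, ‖b n‖ ≤ 1 / cfDen α (n + 1))

include hα hl in
theorem tendsto_cfDen_cast : Tendsto (fun n => (cfDen α n : ℝ)) l atTop :=
  (tendsto_natCast_atTop_atTop.comp (tendsto_cfDen hα)).mono_left hl

include hb hts in
theorem norm_shift_rpow_le (hs : 0 < s) (n : ℕ) :
    ‖b n‖ ^ s ≤ ((cfDen α (n + 1) : ℝ) ^ t)⁻¹ := by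
  have hQ : (1 : ℝ) ≤ cfDen α (n + 1) := by exact_mod_cast cfDen_pos α (n + 1)
  calc ‖b n‖ ^ s ≤ (1 / (cfDen α (n + 1) : ℝ)) ^ s :=
        Real.rpow_le_rpow (norm_nonneg _) (hb n) hs.le
    _ = ((cfDen α (n + 1) : ℝ) ^ s)⁻¹ := by rw [one_div, Real.inv_rpow (by linarith)]
    _ ≤ _ := by
        gcongr

include hτ hτ1 hα hc htτ hl hres in
-- The distance times Q is at least exp(cq), which eventually beats 4q².
theorem eventually_resonance : ∀ᶠ n in l, ∀ i,
    4 * (cfDen α n : ℝ) ^ 2 ≤ ‖cfDen α n • (θ - z i)‖ * cfDen α (n + 1) := by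
  have h1 := ((tendsto_pow_mul_exp_neg hc 2).comp
    (tendsto_cfDen_cast hα hl)).eventually_lt_const (show (0 : ℝ) < 1 / 4 by norm_num)
  filter_upwards [h1, hres] with n hn hr i
  have h2 := exp_le_norm_mul (θ := θ) hτ hτ1
    (by exact_mod_cast cfDen_pos α (n + 1)) hc.le htτ hr i
  refine le_trans ?_ h2
  simp only [Function.comp_apply, Real.exp_neg] at hn
  rw [← div_eq_mul_inv, div_lt_iff₀ (Real.exp_pos _)] at hn
  linarith

include hres in
theorem eventually_smallDivisor_pos : ∀ᶠ n in l, 0 < smallDivisor z τ θ (cfDen α n) := by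
  filter_upwards [hres] with n hn
  by_contra h
  have h1 := mul_nonpos_of_nonpos_of_nonneg (not_lt.1 h)
    (Real.rpow_nonneg (Nat.cast_nonneg (cfDen α (n + 1))) t)
  linarith [Real.exp_pos (c * cfDen α n)]

include hfac hτ hτ1 hc₀ hF hα hc hts htτ hl hres hb

/-- Each factor at θ is at least a constant times G / q^m, while the shift moves it by O(Q^(-t)).
The accumulated relative error is O(q^(m+1) exp(-cq)), eventually at most 1. -/
theorem eventually_abs_orbitProd_le (hs : 0 < s) {Cf : ℝ} (hCf : 0 ≤ Cf)
    (hf : ∀ x y, |f (x + y) - f x| ≤ Cf * ‖y‖ ^ s) :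
    ∀ᶠ n in l, |orbitProd f (α : UnitAddCircle) (cfDen α n) (θ + b n)|
      ≤ |orbitProd f (α : UnitAddCircle) (cfDen α n) θ| * Real.exp 1 := by
  have h1 := (((tendsto_pow_mul_exp_neg hc (m + 1)).comp
    (tendsto_cfDen_cast hα hl)).const_mul (Cf / c₀)).eventually_lt_const
      (show Cf / c₀ * 0 < (1 : ℝ) by simp)
  filter_upwards [h1, hres, eventually_resonance hτ hτ1 hα hc htτ hl hres,
    eventually_smallDivisor_pos hres] with n hn hr hres' hG
  set q := cfDen α n with hq
  set Q := (cfDen α (n + 1) : ℝ) with hQ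
  set G := smallDivisor z τ θ q with hGdef
  have hq0 : 0 < q := cfDen_pos α n
  have hq0' : (0 : ℝ) < q := by exact_mod_cast hq0
  have hQ0 : 0 < Q := by rw [hQ]; exact_mod_cast cfDen_pos α (n + 1)
  have hκ : 0 < c₀ * (G / (q : ℝ) ^ m) := by positivity
  have h2 := abs_orbitProd_add_le (f := f) (a := (α : UnitAddCircle)) (θ := θ) (b := b n) (q := q)
    (κ := c₀ * (G / (q : ℝ) ^ m)) (ρ := Cf * (Q ^ t)⁻¹) hκ
    (fun j hj => smallDivisor_div_le_abs hfac hτ hτ1 hq0 hQ0 (abs_sub_convergent_le hα n) hres'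
      hF hj) (by positivity)
    (fun x => (hf x _).trans (by gcongr; exact norm_shift_rpow_le hts hb hs n))
  refine h2.trans ?_
  gcongr
  calc (q : ℝ) * (Cf * (Q ^ t)⁻¹ / (c₀ * (G / (q : ℝ) ^ m)))
      = Cf / c₀ * ((q : ℝ) ^ (m + 1) * (G * Q ^ t)⁻¹) := by
        field_simp
        ring
    _ ≤ Cf / c₀ * ((q : ℝ) ^ (m + 1) * (Real.exp (c * q))⁻¹) := by gcongr
    _ ≤ 1 := by
      rw [← Real.exp_neg]
      exact hn.le

theorem tendsto_norm_cocycle_shift_sub_div {R : Type*} [NormedRing R] {B : UnitAddCircle → R}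
    (hFc : Continuous F) (hs : 0 < s) {CB : ℝ} (hCB : 0 ≤ CB)
    (hB : ∀ x y, ‖B (x + y) - B x‖ ≤ CB * ‖y‖ ^ s) {ψ : UnitAddCircle → ℝ} (hψ : Continuous ψ)
    {K : ℝ} (hK : 1 ≤ K) (hBψ : ∀ n x, ‖cocycle B (α : UnitAddCircle) n x‖
      ≤ K * Real.exp (∑ i ∈ Finset.range n, ψ (x + i • (α : UnitAddCircle))))
    (hint : (∫ x, ψ x) - (∫ x, Real.log |F x|) + (∑ i, τ i) * Real.log 2 < c) :
    Tendsto (fun n => ‖cocycle B (α : UnitAddCircle) (cfDen α n) (θ + b n)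
        - cocycle B (α : UnitAddCircle) (cfDen α n) θ‖
      / |orbitProd f (α : UnitAddCircle) (cfDen α n) θ|) l (𝓝 0) := by
  have hF0 : ∀ x, F x ≠ 0 := fun x => abs_pos.1 (hc₀.trans_le (hF x))
  have hlogF := continuous_log_abs hFc hF0
  obtain ⟨Cψ, -, hCψ⟩ := exists_norm_le_of_continuous hψ
  -- The spare exponent d is spent as d/4 on the shift of ψ and d/4 on equidistribution; the
  -- remaining d/2 gives decay that beats the prefactor q.
  set d := c - ((∫ x, ψ x) - (∫ x, Real.log |F x|) + (∑ i, τ i) * Real.log 2) with hd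
  have hd0 : 0 < d := by rw [hd]; linarith
  set K' := K ^ 2 * CB * Real.exp Cψ with hK'
  have hunif : ∀ᶠ n in l, ∀ x, ψ (x + b n) - ψ x ≤ d / 4 := by
    obtain ⟨r, hr, hr'⟩ := Metric.uniformContinuous_iff.1
      (CompactSpace.uniformContinuous_of_continuous hψ) (d / 4) (by positivity)
    have h1 : Tendsto (fun n => 1 / (cfDen α (n + 1) : ℝ)) atTop (𝓝 0) :=
      ((tendsto_cfDen_cast hα le_rfl).comp (tendsto_add_atTop_nat 1)).inv_tendsto_atTop.congr
        fun n => by simp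
    filter_upwards [(h1.mono_left hl).eventually_lt_const hr] with n hn x
    have h2 : dist (x + b n) x < r := by
      rw [dist_eq_norm, add_sub_cancel_left]
      exact (hb n).trans_lt hn
    exact (le_abs_self _).trans (hr' h2).le
  have havg : ∀ᶠ n in l, ∑ j ∈ Finset.range (cfDen α n), ψ (θ + j • (α : UnitAddCircle))
      - ∑ j ∈ Finset.range (cfDen α n), Real.log |F (θ + j • (α : UnitAddCircle))|
      ≤ cfDen α n * ((∫ x, ψ x) - (∫ x, Real.log |F x|) + d / 4) := by
    have h1 := ((tendsto_average hα θ (hψ.sub hlogF)).comp (tendsto_cfDen hα)).mono_left hl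
    simp only [Pi.sub_apply] at h1
    rw [integral_sub (integrable_of_continuous hψ) (integrable_of_continuous hlogF)] at h1
    filter_upwards [h1.eventually_lt_const (show (∫ x, ψ x) - (∫ x, Real.log |F x|) <
      (∫ x, ψ x) - (∫ x, Real.log |F x|) + d / 4 by linarith)] with n hn
    have hq0 : (0 : ℝ) < cfDen α n := by exact_mod_cast cfDen_pos α n
    simp only [Function.comp_apply] at hn
    rw [inv_mul_lt_iff₀ hq0, Finset.sum_sub_distrib] at hn
    exact hn.le
  have hlim := ((tendsto_pow_mul_exp_neg (show 0 < d / 2 by positivity) 1).comp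
    (tendsto_cfDen_cast hα hl)).const_mul K'
  rw [mul_zero] at hlim
  refine squeeze_zero' (Eventually.of_forall fun n => by positivity) ?_ hlim
  filter_upwards [hunif, havg, hres, eventually_resonance hτ hτ1 hα hc htτ hl hres,
    eventually_smallDivisor_pos hres] with n hn hav hr hres' hG
  have hlow := orbitProd_lower_bound hfac hτ (cfDen_pos α n)
    (by exact_mod_cast cfDen_pos α (n + 1)) (abs_sub_convergent_le hα n) hres'
    (isCoprime_num_cfDen α n) hF0
  have hup := norm_cocycle_add_sub_le (θ := θ) hK (show 0 ≤ d / 4 by positivity) hCψ hBψ hn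
    (fun x => (hB x (b n)).trans (mul_le_mul_of_nonneg_left
      (norm_shift_rpow_le hts hb hs n) hCB)) (cfDen α n)
  set q := cfDen α n with hq
  set Q := (cfDen α (n + 1) : ℝ) with hQ
  set G := smallDivisor z τ θ q with hGdef
  set S₁ := ∑ j ∈ Finset.range q, ψ (θ + j • (α : UnitAddCircle)) with hS₁
  set S₂ := ∑ j ∈ Finset.range q, Real.log |F (θ + j • (α : UnitAddCircle))| with hS₂
  have hQ0 : 0 < Q := by rw [hQ]; exact_mod_cast cfDen_pos α (n + 1)
  have hden : 0 < Real.exp (S₂ - q * ((∑ i, τ i) * Real.log 2)) * G := by positivity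
  calc _ ≤ (q * (K ^ 2 * (CB * (Q ^ t)⁻¹) * Real.exp Cψ) * Real.exp (S₁ + q * (d / 4)))
        / (Real.exp (S₂ - q * ((∑ i, τ i) * Real.log 2)) * G) := by gcongr
    _ = K' * (q * ((G * Q ^ t)⁻¹ * Real.exp (S₁ + q * (d / 4)
          - (S₂ - q * ((∑ i, τ i) * Real.log 2))))) := by
        rw [Real.exp_sub (S₁ + q * (d / 4)), hK']
        field_simp
    _ ≤ K' * (q * ((Real.exp (c * q))⁻¹ * Real.exp (S₁ + q * (d / 4)
          - (S₂ - q * ((∑ i, τ i) * Real.log 2))))) := by gcongr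
    _ ≤ K' * (q ^ 1 * Real.exp (-(d / 2 * q))) := by
        rw [← Real.exp_neg, ← Real.exp_add, pow_one]
        gcongr
        have : c = d + ((∫ x, ψ x) - (∫ x, Real.log |F x|) + (∑ i, τ i) * Real.log 2) := by
          rw [hd]; ring
        rw [this]
        nlinarith

end ShiftEstimates

/-! ### Solutions of the difference equation as columns -/

section Solution

/-- The matrix with first column `(w k, w (k - 1))` and second column zero. -/
def solutionColumn (w : ℤ → ℝ) (k : ℤ) : Matrix (Fin 2) (Fin 2) ℝ :=
  !![w k, 0; w (k - 1), 0]

theorem tendsto_solutionColumn {w : ℤ → ℝ} {ι : Type*} {l : Filter ι} {k : ι → ℤ}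
    (h0 : Tendsto (fun i => w (k i)) l (𝓝 0)) (h1 : Tendsto (fun i => w (k i - 1)) l (𝓝 0)) :
    Tendsto (fun i => solutionColumn w (k i)) l (𝓝 0) := by
  have h : ∀ i, solutionColumn w (k i) = w (k i) • !![1, 0; 0, 0]
      + w (k i - 1) • (!![0, 0; 1, 0] : Matrix (Fin 2) (Fin 2) ℝ) := by
    intro i
    ext a b
    fin_cases a <;> fin_cases b <;> simp [solutionColumn]
  simp only [h]
  simpa using (h0.smul_const (!![1, 0; 0, 0] : Matrix (Fin 2) (Fin 2) ℝ)).add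
    (h1.smul_const (!![0, 0; 1, 0] : Matrix (Fin 2) (Fin 2) ℝ))

variable {f g : UnitAddCircle → ℝ} {α E : ℝ} {θ : UnitAddCircle} {w : ℤ → ℝ}
  (hw : ∀ k, w (k + 1) + w (k - 1) + potential f g α θ k * w k = E * w k)
include hw

theorem cocycle_mul_solutionColumn (n : ℕ) (k : ℤ) :
    cocycle (transfer f g E) (α : UnitAddCircle) n (θ + k • (α : UnitAddCircle))
      * solutionColumn w k = solutionColumn w (k + n) := by
  induction n with
  | zero => simp
  | succ n ih =>
    have h := hw (k + n)
    rw [potential, orbit, add_smul, natCast_zsmul, ← add_assoc] at h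
    rw [cocycle_succ, mul_assoc, ih]
    ext i j
    fin_cases i <;> fin_cases j <;>
      simp [solutionColumn, transfer, ← add_assoc]
    linear_combination -h

theorem eq_zero_of_solutionColumn_eq_zero (h0 : solutionColumn w 0 = 0) : w = 0 := by
  have h1 : w 0 = 0 := by simpa [solutionColumn] using congrFun (congrFun h0 0) 0
  have h2 : w (-1) = 0 := by simpa [solutionColumn] using congrFun (congrFun h0 1) 0
  have hp : ∀ n : ℕ, w n = 0 ∧ w (n - 1) = 0 := by
    intro n
    induction n with
    | zero => simpa using ⟨h1, h2⟩
    | succ n ih =>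
      have h := hw n
      rw [ih.1, ih.2] at h
      push_cast
      rw [add_sub_cancel_right]
      exact ⟨by linarith, ih.1⟩
  have hn : ∀ n : ℕ, w (-n) = 0 ∧ w (-n - 1) = 0 := by
    intro n
    induction n with
    | zero => simpa using ⟨h1, h2⟩
    | succ n ih =>
      have h := hw (-n - 1)
      rw [sub_add_cancel, ih.1, ih.2] at h
      push_cast
      rw [neg_add']
      exact ⟨ih.2, by linarith⟩
  funext k
  obtain ⟨n, rfl | rfl⟩ := k.eq_nat_or_neg
  · exact (hp n).1
  · exact (hn n).1

end Solution

theorem exists_frequently_lt_deltaIndex {τ₀ : ℝ≥0} {m : ℕ} {z : Fin m → UnitAddCircle}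
    {τ : Fin m → ℝ} (hτ : ∀ l, 0 < τ l) {α L : ℝ} {θ : UnitAddCircle}
    (h : (L : EReal) < deltaIndex τ₀ z τ α θ) :
    ∃ c : ℝ, L < c ∧ ∃ᶠ n in atTop, Real.exp (c * cfDen α n)
      ≤ smallDivisor z τ θ (cfDen α n) * (cfDen α (n + 1) : ℝ) ^ tauMin τ₀ τ := by
  obtain ⟨c, hLc, hc⟩ := EReal.lt_iff_exists_real_btwn.1 h
  refine ⟨c, by exact_mod_cast hLc, (frequently_lt_of_lt_limsup (by isBoundedDefault) hc).mono
    fun n hn => ?_⟩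
  exact exp_le_smallDivisor_mul_rpow (cfDen_pos α n) hτ
    (by exact_mod_cast cfDen_pos α (n + 1)) hn

theorem tendsto_shift_of_cofinite {w : ℤ → ℝ} (hw : Tendsto w cofinite (𝓝 0)) {ι : Type*}
    {l : Filter ι} {r : ι → ℝ} {k : ι → ℤ} (hk : Tendsto k l cofinite)
    (hr : ∃ C, ∀ᶠ i in l, |r i| ≤ C) :
    Tendsto (fun i => r i • solutionColumn w (k i)) l (𝓝 0) := by
  have h1 : Tendsto (fun i => solutionColumn w (k i)) l (𝓝 0) :=
    tendsto_solutionColumn (hw.comp hk)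
      (hw.comp ((sub_left_injective (b := (1 : ℤ))).tendsto_cofinite.comp hk))
  obtain ⟨C, hC⟩ := hr
  exact (Asymptotics.IsBigO.of_bound C (hC.mono fun i hi => by simpa using hi)
    : r =O[l] fun _ => (1 : ℝ)).smul_isLittleO ((Asymptotics.isLittleO_one_iff ℝ).2 h1)
    |>.tendsto_zero_of_tendsto (by simpa using tendsto_const_nhds)

/-! ### Absence of decaying solutions -/

section Absence

variable {τ₀ : ℝ≥0} {f g : UnitAddCircle → ℝ} {m : ℕ} {z : Fin m → UnitAddCircle}
  {τ : Fin m → ℝ}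

theorem ClassF.ae_ne_zero (hF : ClassF f z τ) : ∀ᵐ x, f x ≠ 0 := by
  obtain ⟨F, -, ⟨c₀, hc₀, hc⟩, hfac⟩ := hF.factor
  exact ae_ne_zero_of_factor hfac fun x => abs_pos.1 (hc₀.trans_le (hc x))

theorem ClassF.integrable_log_abs (hF : ClassF f z τ) :
    Integrable (fun x => Real.log |f x|) volume := by
  obtain ⟨F, hFc, ⟨c₀, hc₀, hc⟩, hfac⟩ := hF.factor
  exact (integral_log_abs_of_factor hfac hF.exponent_pos hFc
    fun x => abs_pos.1 (hc₀.trans_le (hc x))).1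

theorem eq_zero_of_tendsto_zero_of_lt_deltaIndex (hτ₀ : 0 < τ₀) (hf : IsHolder τ₀ f)
    (hg : IsHolder τ₀ g) (hF : ClassF f z τ) {α : ℝ} (hα : Irrational α) {θ : UnitAddCircle}
    (hθ : ∀ n : ℤ, f (orbit α θ n) ≠ 0) {E L : ℝ} (hL0 : 0 ≤ L)
    (hL : Tendsto (fun n : ℕ =>
      (∫ x, Real.log ‖cocycle (transfer f g E) (α : UnitAddCircle) n x‖) / n) atTop (𝓝 L))
    (hδ : (L : EReal) < deltaIndex τ₀ z τ α θ) {w : ℤ → ℝ}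
    (hw : ∀ k, w (k + 1) + w (k - 1) + potential f g α θ k * w k = E * w k)
    (hw0 : Tendsto w cofinite (𝓝 0)) : w = 0 := by
  obtain ⟨Cf, hf⟩ := hf
  obtain ⟨Cg, hg⟩ := hg
  have hfc : Continuous f := hf.continuous hτ₀
  have hgc : Continuous g := hg.continuous hτ₀
  obtain ⟨F, hFc, ⟨c₀, hc₀, hFlow⟩, hfac⟩ := hF.factor
  obtain ⟨hlog, hlogval⟩ := integral_log_abs_of_factor hfac hF.exponent_pos hFc
    fun x => abs_pos.1 (hc₀.trans_le (hFlow x))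
  obtain ⟨c, hLc, hfreq⟩ := exists_frequently_lt_deltaIndex hF.exponent_pos hδ
  -- The choice ε = (c - L)/2 keeps the mean of ψ strictly below c + ∫ log |f|.
  obtain ⟨ψ, K, hψ, hK, hDψ, hint⟩ := exists_continuous_rate hfc hgc hF.ae_ne_zero hlog E
    (α : UnitAddCircle) hL (show 0 < (c - L) / 2 by linarith)
  set a : UnitAddCircle := (α : UnitAddCircle) with ha
  set q : ℕ → ℕ := cfDen α with hq
  set S := {n : ℕ | Real.exp (c * q n) ≤ smallDivisor z τ θ (q n) * (q (n + 1) : ℝ) ^ tauMin τ₀ τ}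
    with hS
  -- This filter plays the role of a subsequence of good denominators; it is nontrivial because
  -- these occur frequently.
  set l : Filter ℕ := atTop ⊓ 𝓟 S with hl
  have : l.NeBot := frequently_iff_neBot.1 hfreq
  have hle : l ≤ atTop := inf_le_left
  have hres : ∀ᶠ n in l, Real.exp (c * q n)
      ≤ smallDivisor z τ θ (q n) * (q (n + 1) : ℝ) ^ tauMin τ₀ τ :=
    mem_inf_of_right (mem_principal_self S)
  have hc0 : 0 < c := hL0.trans_lt hLc
  have hqa : ∀ n, ‖q n • a‖ ≤ 1 / q (n + 1) := fun n =>
    norm_nsmul_coe_le (cfDen_pos α n) (abs_sub_convergent_le hα n)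
  have hqa' : ∀ n, ‖-(q n • a)‖ ≤ 1 / q (n + 1) := fun n => by rw [norm_neg]; exact hqa n
  have hs : 0 < (τ₀ : ℝ) := hτ₀
  set D := regTransfer f g E with hD
  set A := transfer f g E with hA
  have hbd : ∀ {b : ℕ → UnitAddCircle}, (∀ n, ‖b n‖ ≤ 1 / q (n + 1)) →
      ∀ᶠ n in l, |orbitProd f a (q n) (θ + b n)| ≤ |orbitProd f a (q n) θ| * Real.exp 1 :=
    fun hb => eventually_abs_orbitProd_le hfac hF.exponent_pos hF.exponent_le_one hc₀ hFlow hα hc0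
      (tauMin_le_base τ₀ τ) (tauMin_le τ₀ τ) hle hres hb hs Cf.2
      (abs_add_sub_le_of_holderWith hf)
  have hdiff : ∀ {b : ℕ → UnitAddCircle}, (∀ n, ‖b n‖ ≤ 1 / q (n + 1)) →
      Tendsto (fun n => ‖cocycle D a (q n) (θ + b n) - cocycle D a (q n) θ‖
        / |orbitProd f a (q n) θ|) l (𝓝 0) :=
    fun hb => tendsto_norm_cocycle_shift_sub_div hfac hF.exponent_pos hF.exponent_le_one hc₀ hFlow
      hα hc0 (tauMin_le_base τ₀ τ) (tauMin_le τ₀ τ) hle hres hb hFc hs (by positivity)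
      (norm_regTransfer_add_sub_le hf hg E) hψ hK hDψ (by rw [hlogval] at hint; linarith)
  have hne : ∀ (k : ℤ) (j : ℕ), f (θ + k • a + j • a) ≠ 0 := by
    intro k j
    have := hθ (k + j)
    rwa [orbit, add_smul, natCast_zsmul, ← add_assoc] at this
  have hne0 : ∀ j : ℕ, f (θ + j • a) ≠ 0 := fun j => by simpa using hne 0 j
  have hP : ∀ n, orbitProd f a n θ ≠ 0 := fun n => Finset.prod_ne_zero_iff.2 fun j _ => hne0 j
  have hratio : ∀ {b : ℕ → UnitAddCircle}, (∀ n, ‖b n‖ ≤ 1 / q (n + 1)) →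
      ∃ C, ∀ᶠ n in l, |orbitProd f a (q n) (θ + b n) / orbitProd f a (q n) θ| ≤ C := by
    intro b hb
    refine ⟨Real.exp 1, (hbd hb).mono fun n hn => ?_⟩
    rw [abs_div, div_le_iff₀ (abs_pos.2 (hP _)), mul_comm]
    exact hn
  have hqtop : Tendsto (fun n => (q n : ℤ)) l atTop :=
    (tendsto_natCast_atTop_atTop.comp (tendsto_cfDen hα)).mono_left hle
  have hcof : Tendsto (fun n => (q n : ℤ)) l cofinite :=
    hqtop.mono_right (by rw [Int.cofinite_eq]; exact le_sup_right)
  have hcof2 : Tendsto (fun n => (q n + q n : ℤ)) l cofinite :=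
    (hqtop.atTop_add_atTop hqtop).mono_right (by rw [Int.cofinite_eq]; exact le_sup_right)
  have hcofneg : Tendsto (fun n => (-q n : ℤ)) l cofinite :=
    (tendsto_neg_atTop_atBot.comp hqtop).mono_right (by rw [Int.cofinite_eq]; exact le_sup_left)
  have hW : Tendsto (fun n => solutionColumn w (q n)) l (𝓝 0) := by
    simpa using tendsto_shift_of_cofinite hw0 hcof (r := fun _ => 1)
      ⟨1, Eventually.of_forall fun _ => by simp⟩
  have hstep : ∀ (n : ℕ) (k : ℤ), cocycle A a n (θ + k • a) * solutionColumn w k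
      = solutionColumn w (k + n) := cocycle_mul_solutionColumn hw
  have hstep0 : ∀ n, cocycle A a n θ * solutionColumn w 0 = solutionColumn w n := fun n => by
    simpa using hstep n 0
  have hDA : ∀ n (k : ℤ), cocycle D a n (θ + k • a)
      = orbitProd f a n (θ + k • a) • cocycle A a n (θ + k • a) := fun n k =>
    cocycle_regTransfer_eq_smul E a n (hne k)
  have hDA0 : ∀ n, cocycle D a n θ = orbitProd f a n θ • cocycle A a n θ := fun n =>
    cocycle_regTransfer_eq_smul E a n hne0
  refine eq_zero_of_solutionColumn_eq_zero hw
    (eq_zero_of_tendsto_mul (M := fun n => cocycle A a (q n) θ) (l := l)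
      (fun n => det_cocycle_transfer f g E a (q n) θ) ?_ ?_ ?_)
  · simpa only [hstep0] using hW
  -- The adjugate of A_q(θ - qα) carries W(0) back to W(-q). The adjugate is linear on 2 × 2
  -- matrices, so the error term is the adjugate of the difference of the regularised cocycles.
  · have h1 := tendsto_shift_of_cofinite hw0 hcofneg (hratio hqa')
    have h2 : Tendsto (fun n => (orbitProd f a (q n) θ)⁻¹ •
        (cocycle D a (q n) (θ + -(q n • a)) - cocycle D a (q n) θ).adjugate) l (𝓝 0) := by
      refine squeeze_zero_norm (fun n => ?_) (hdiff hqa')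
      rw [norm_smul, norm_inv, Real.norm_eq_abs, inv_mul_eq_div]
      gcongr
      exact norm_adjugate_fin_two_le _
    have h3 := h1.sub (h2.mul_const (solutionColumn w 0))
    rw [zero_mul, sub_zero] at h3
    refine h3.congr fun n => ?_
    have e1 := hDA (q n) (-(q n : ℤ))
    have e2 := hstep (q n) (-(q n : ℤ))
    rw [neg_smul, natCast_zsmul] at e1 e2
    rw [neg_add_cancel] at e2
    have e3 : (cocycle A a (q n) (θ + -(q n • a))).adjugate * solutionColumn w 0
        = solutionColumn w (-(q n : ℤ)) := by
      rw [← e2, ← mul_assoc, Matrix.adjugate_mul, det_cocycle_transfer, one_smul, one_mul]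
    rw [adjugate_fin_two_sub, e1, hDA0, adjugate_fin_two_smul, adjugate_fin_two_smul, smul_mul_assoc,
      sub_mul, smul_mul_assoc, smul_mul_assoc, e3, smul_sub, smul_smul, smul_smul,
      inv_mul_cancel₀ (hP _), one_smul, div_eq_inv_mul, sub_sub_cancel]
  -- Here A_q(θ + qα) sends W(q) to W(2q), and M W(0) = W(q), so the error acts on a column that
  -- itself tends to zero.
  · have h1 := tendsto_shift_of_cofinite hw0 hcof2 (hratio hqa)
    have h2 : Tendsto (fun n => (orbitProd f a (q n) θ)⁻¹ •
        (cocycle D a (q n) (θ + q n • a) - cocycle D a (q n) θ)) l (𝓝 0) := by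
      refine squeeze_zero_norm (fun n => ?_) (hdiff hqa)
      rw [norm_smul, norm_inv, Real.norm_eq_abs, inv_mul_eq_div]
    have h3 := h1.sub (h2.mul hW)
    rw [zero_mul, sub_zero] at h3
    refine h3.congr fun n => ?_
    have e1 := hDA (q n) (q n : ℤ)
    have e2 := hstep (q n) (q n : ℤ)
    rw [natCast_zsmul] at e1 e2
    rw [hstep0, e1, hDA0, smul_mul_assoc, sub_mul, smul_mul_assoc, smul_mul_assoc, e2, smul_sub,
      smul_smul, smul_smul, inv_mul_cancel₀ (hP _), one_smul, div_eq_inv_mul, sub_sub_cancel]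

end Absence

/-! ### From an eigenvector to a real decaying solution -/

section Eigenvalue

theorem tendsto_cofinite_of_ellTwo (u : EllTwo) : Tendsto (fun k => u k) cofinite (𝓝 0) := by
  have h := (lp.memℓp u).summable (by norm_num)
  have h2 := h.tendsto_cofinite_zero
  rw [tendsto_zero_iff_norm_tendsto_zero]
  have h3 := h2.rpow_const (p := 1 / 2) (Or.inr (by norm_num))
  rw [Real.zero_rpow (by norm_num)] at h3
  refine h3.congr fun k => ?_
  rw [← Real.rpow_mul (norm_nonneg _)]
  norm_num

/-- The potential and E are real, so the real and imaginary parts of an eigenvector are both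
solutions, and one of them is nonzero. -/
theorem IsEigenvalue.exists_real_solution {V : ℤ → ℝ} {E : ℝ}
    (h : IsEigenvalue (schrodinger V) (E : ℂ)) :
    ∃ w : ℤ → ℝ, w ≠ 0 ∧ Tendsto w cofinite (𝓝 0) ∧
      ∀ k, w (k + 1) + w (k - 1) + V k * w k = E * w k := by
  obtain ⟨u, hu0, hu⟩ := h
  have hk : ∀ k : ℤ, (u : EllTwo) (k + 1) + (u : EllTwo) (k - 1) + (V k : ℂ) * (u : EllTwo) k
      = (E : ℂ) * (u : EllTwo) k := fun k => by
    have h1 : ((schrodinger V u : EllTwo) : ℤ → ℂ) k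
        = (((E : ℂ) • (u : EllTwo) : EllTwo) : ℤ → ℂ) k := by
      rw [hu]
    rw [lp.coeFn_smul] at h1
    exact h1
  have hlim := tendsto_cofinite_of_ellTwo (u : EllTwo)
  by_cases hre : (fun k => ((u : EllTwo) k).re) = 0
  · refine ⟨fun k => ((u : EllTwo) k).im, fun him => hu0 ?_, ?_, fun k => ?_⟩
    · refine Subtype.ext (lp.ext (funext fun k => Complex.ext ?_ ?_))
      · exact congrFun hre k
      · exact congrFun him k
    · simpa only [Function.comp_def, Complex.zero_im] using
        (Complex.continuous_im.tendsto _).comp hlim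
    · simpa using congrArg Complex.im (hk k)
  · refine ⟨fun k => ((u : EllTwo) k).re, hre, ?_, fun k => ?_⟩
    · simpa only [Function.comp_def, Complex.zero_re] using
        (Complex.continuous_re.tendsto _).comp hlim
    · simpa using congrArg Complex.re (hk k)

end Eigenvalue

end UnboundedQP

theorem theorem1p1
    (τ₀ : ℝ≥0) (hτ₀_pos : 0 < τ₀) (hτ₀_le : τ₀ ≤ 1)
    (f g : UnitAddCircle → ℝ)
    (hf : UnboundedQP.IsHolder τ₀ f) (hg : UnboundedQP.IsHolder τ₀ g)
    {m : ℕ} (z : Fin m → UnitAddCircle) (τ : Fin m → ℝ)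
    (hF : UnboundedQP.ClassF f z τ)
    (α : ℝ) (hα : Irrational α) :
    -- the Lyapunov exponent is well defined, as a finite limit of integrals that exist
    (∀ E : ℝ,
      (∀ n : ℕ, Integrable (fun x : UnitAddCircle =>
        Real.log ‖UnboundedQP.transferIter f g α E n x‖) volume) ∧
      Tendsto (UnboundedQP.lyapunovAverage f g α E) atTop
        (𝓝 (UnboundedQP.lyapunov f g α E))) ∧
    -- no eigenvalues where the Lyapunov exponent is smaller than the index
    (∀ θ : UnitAddCircle, (∀ n : ℤ, f (UnboundedQP.orbit α θ n) ≠ 0) →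
      ∀ E : ℝ,
        (UnboundedQP.lyapunov f g α E : EReal) < UnboundedQP.deltaIndex τ₀ z τ α θ →
        ¬ UnboundedQP.IsEigenvalue
          (UnboundedQP.schrodinger (UnboundedQP.potential f g α θ)) (E : ℂ)) := by
  have hfc : Continuous f := hf.choose_spec.continuous hτ₀_pos
  have hgc : Continuous g := hg.choose_spec.continuous hτ₀_pos
  have hL : ∀ E : ℝ, ∃ L : ℝ, 0 ≤ L ∧ UnboundedQP.lyapunov f g α E = L ∧
      Tendsto (UnboundedQP.lyapunovAverage f g α E) atTop (𝓝 L) ∧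
      Tendsto (fun n : ℕ => (∫ x, Real.log ‖UnboundedQP.cocycle (UnboundedQP.transfer f g E)
        (α : UnitAddCircle) n x‖) / n) atTop (𝓝 L) := by
    intro E
    obtain ⟨L, hL0, hL⟩ := UnboundedQP.tendsto_integral_log_norm_div hfc hgc hF.ae_ne_zero
      hF.integrable_log_abs E (α : UnitAddCircle)
    have hL' : Tendsto (UnboundedQP.lyapunovAverage f g α E) atTop (𝓝 L) := by
      refine hL.congr fun n => ?_
      simp only [UnboundedQP.lyapunovAverage, UnboundedQP.transferIter_eq_cocycle]
      rw [one_div, div_eq_inv_mul]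
    exact ⟨L, hL0, hL'.limUnder_eq, hL', hL⟩
  refine ⟨fun E => ⟨fun n => ?_, ?_⟩, fun θ hθ E hδ hE => ?_⟩
  · simp only [UnboundedQP.transferIter_eq_cocycle]
    exact UnboundedQP.integrable_log_norm_cocycle_transfer hfc hgc hF.ae_ne_zero
      hF.integrable_log_abs E _ n
  · obtain ⟨L, -, hval, hlim, -⟩ := hL E
    rwa [hval]
  · obtain ⟨L, hL0, hval, -, hlim⟩ := hL E
    rw [hval] at hδ
    obtain ⟨w, hw0, hwlim, hw⟩ := hE.exists_real_solution
    exact hw0 (UnboundedQP.eq_zero_of_tendsto_zero_of_lt_deltaIndex hτ₀_pos hf hg hF hα hθ hL0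
      hlim hδ hw hwlim)
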